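/- Let $F$ be a skew field and let $\Phi=(N,E,\varphi)$ be a gain graph with gains in $F^\times$: the sets $N$ of nodes and $E$ of edges may be infinite, every edge is a link (two distinct endpoints; parallel links are allowed) or a half edge (one endpoint), and each link $e$ with endpoints $v,w$ has a gain $\varphi(e_{vw})\in F^\times$ in the direction from $v$ to $w$, with $\varphi(e_{wv})=\varphi(e_{vw})^{-1}$. A circle (the edge set of a simple closed path of length at least $2$) is \emph{balanced} if the product of its gains, taken around the circle in a consistent direction, is $1$; this gives the biased graph $\langle\Phi\rangle$. Suppose that no two parallel links form a balanced circle and that no node supports two half edges (that is, the frame matroid of $\Phi$ is simple). Let $\mathbb P_N(F)$ be the projective space of the left vector space $F^{N}$ (finitely supported coordinate vectors), let $\hat v$ be the point of the coordinate vector of $v\in N$, let $\hat N=\{\hat v: v\in N\}$, and let $h_\infty$ be the hyperplane $\sum_{v}x_v=0$. For a half edge $e$ at $v$ put $\hat e=\hat v$. For a link $e$ with endpoints $v,w$ put $\hat e=\frac1{1-\varphi(e_{vw})}(\hat v-\varphi(e_{vw})\hat w)$ if $\varphi(e_{vw})\ne1$, and $\hat e=h_\infty\wedge\hat v\hat w$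 if $\varphi(e_{vw})=1$. Let $\mathcal M[\Phi]=\{\hat e: e\in E\}$. Let $\Omega(\mathcal M[\Phi])$ be the graph with one node for each point of $\hat N$ and one edge for each point $p\in\mathcal M[\Phi]$, where $p$ is a half edge at $p$ if $p\in\hat N$, and otherwise a link whose endpoints are the two points of $\hat N$ whose line contains $p$; call a circle in it balanced if its points lie in a flat of $\mathbb P_N(F)$ that is disjoint from $\hat N$. Then $\langle\Phi\rangle$ and $\Omega(\mathcal M[\Phi])$ are biased graphs (no theta graph contains exactly two balanced circles), and $v\mapsto\hat v$, $e\mapsto\hat e$ define an isomorphism of biased graphs $\langle\Phi\rangle\cong\Omega(\mathcal M[\Phi])$. Moreover, $e\mapsto\hat e$ is an isomorphism of matroids from the frame matroid $G(\Phi)$ onto the matroid $M(\mathcal M[\Phi])$ of projective dependence of the point set $\mathcal M[\Phi]$. Here $G(\Phi)$ is the matroid on $E$ whose circuits are the balanced circles, the theta graphs without balanced circle, and the unions of two unbalanced figures (half edges or unbalanced circles) that either have exactly one common node, or have no common node and are joined by a path (included in the union) that meets each of them exactly in one of its endpoints. -/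

import Mathlib

open scoped LinearAlgebra.Projectivization

/-! ### Graphs with links and half edges -/

/-- A graph with node set `N` and edge set `E`, both possibly infinite, in which every edge is a
link (two distinct endpoints; parallel links are allowed) or a half edge (one endpoint).
A link with endpoints `v ≠ w` has `ends e = s(v, w)`; a half edge at `v` has `ends e = s(v, v)`.
There are no graph loops and no loose edges. -/
structure HalfEdgeGraph (N E : Type*) where
  /-- the endpoint (half edge) or the two endpoints (link) of an edge -/
  ends : E → Sym2 N

namespace HalfEdgeGraph

variable {N E : Type*} (Γ : HalfEdgeGraph N E)

/-- `N(S)`, the set of endpoints of the edges in `S`. -/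
def nodes (S : Set E) : Set N := {v | ∃ e ∈ S, v ∈ Γ.ends e}

/-- The distinct nodes `v 0, …, v (n+1)` and the distinct edges `e 0, …, e (n+1)` run around a
simple closed path of length `n + 2 ≥ 2`; the edge `e i` joins `v i` to `v (i + 1)`, where `i + 1`
is taken cyclically in `Fin (n + 2)`. -/
def IsCircleSeq {n : ℕ} (v : Fin (n + 2) → N) (e : Fin (n + 2) → E) : Prop :=
  Function.Injective v ∧ Function.Injective e ∧ ∀ i, Γ.ends (e i) = s(v i, v (i + 1))

/-- A circle: the edge set of a simple closed path (a digon, i.e. two parallel links, is a circle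
of length `2`). -/
def IsCircle (C : Set E) : Prop :=
  ∃ (n : ℕ) (v : Fin (n + 2) → N) (e : Fin (n + 2) → E),
    Γ.IsCircleSeq v e ∧ C = Set.range e

/-- `P` is the edge set of a simple path from `u` to `w`. -/
def IsPath (P : Set E) (u w : N) : Prop :=
  ∃ (n : ℕ) (v : Fin (n + 1) → N) (e : Fin n → E),
    Function.Injective v ∧ v 0 = u ∧ v (Fin.last n) = w ∧
    (∀ i, Γ.ends (e i) = s(v i.castSucc, v i.succ)) ∧ P = Set.range e

/-- `P`, `Q`, `R` are three internally disjoint paths with the same two endpoints, so that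
`P ∪ Q ∪ R` is a theta graph. Its circles are `P ∪ Q`, `Q ∪ R` and `P ∪ R`. -/
def IsTheta (P Q R : Set E) : Prop :=
  ∃ u w : N, u ≠ w ∧ Γ.IsPath P u w ∧ Γ.IsPath Q u w ∧ Γ.IsPath R u w ∧
    Disjoint P Q ∧ Disjoint Q R ∧ Disjoint P R ∧
    Γ.nodes P ∩ Γ.nodes Q = {u, w} ∧ Γ.nodes Q ∩ Γ.nodes R = {u, w} ∧
    Γ.nodes P ∩ Γ.nodes R = {u, w}

end HalfEdgeGraph

/-! ### Biased graphs and their frame matroids -/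

/-- A graph together with a class of circles. It is a biased graph when the class is linear,
see `GraphWithCircles.IsBiasedGraph`. -/
structure GraphWithCircles (N E : Type*) extends HalfEdgeGraph N E where
  /-- the class of balanced circles -/
  balanced : Set (Set E)
  isCircle_of_mem : ∀ C ∈ balanced, toHalfEdgeGraph.IsCircle C

namespace GraphWithCircles

variable {N E : Type*} (Ω : GraphWithCircles N E)

/-- `Ω` is a biased graph: no theta graph has exactly two balanced circles, i.e. if two circles
of a theta graph are balanced then so is the third one. -/
def IsBiasedGraph : Prop :=
  ∀ P Q R : Set E, Ω.IsTheta P Q R →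
    P ∪ Q ∈ Ω.balanced → Q ∪ R ∈ Ω.balanced → P ∪ R ∈ Ω.balanced

/-- An unbalanced figure: a half edge or an unbalanced circle. -/
def IsUnbalancedFigure (S : Set E) : Prop :=
  (∃ e v, Ω.ends e = s(v, v) ∧ S = {e}) ∨ (Ω.IsCircle S ∧ S ∉ Ω.balanced)

/-- Frame circuits: a balanced circle; a theta graph without balanced circle; two unbalanced
figures with a single common node; two unbalanced figures without common nodes, together with
a path that meets each of the figures exactly in one of its two endpoints. -/
def IsFrameCircuit (C : Set E) : Prop :=
  C ∈ Ω.balanced ∨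
  (∃ P Q R : Set E, Ω.IsTheta P Q R ∧ P ∪ Q ∉ Ω.balanced ∧ Q ∪ R ∉ Ω.balanced ∧
    P ∪ R ∉ Ω.balanced ∧ C = P ∪ Q ∪ R) ∨
  (∃ (A B : Set E) (v : N), Ω.IsUnbalancedFigure A ∧ Ω.IsUnbalancedFigure B ∧
    Disjoint A B ∧ Ω.nodes A ∩ Ω.nodes B = {v} ∧ C = A ∪ B) ∨
  (∃ (A B P : Set E) (u w : N), Ω.IsUnbalancedFigure A ∧ Ω.IsUnbalancedFigure B ∧
    Disjoint (Ω.nodes A) (Ω.nodes B) ∧ Ω.IsPath P u w ∧ Ω.nodes P ∩ Ω.nodes A = {u} ∧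
    Ω.nodes P ∩ Ω.nodes B = {w} ∧ C = A ∪ P ∪ B)

/-- `M` is the frame matroid `G(Ω)`: its ground set is the set of all edges and its circuits are
the frame circuits. -/
def IsFrameMatroid (M : Matroid E) : Prop :=
  M.E = Set.univ ∧ ∀ C : Set E, M.IsCircuit C ↔ Ω.IsFrameCircuit C

/-- There is at most one frame matroid of `Ω`. -/
theorem IsFrameMatroid.unique {M M' : Matroid E} (h : Ω.IsFrameMatroid M)
    (h' : Ω.IsFrameMatroid M') : M = M' :=
  Matroid.ext_isCircuit (h.1.trans h'.1.symm) fun C _ => (h.2 C).trans (h'.2 C).symm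

/-- Isomorphism of biased graphs: an isomorphism of the underlying graphs, given by a bijection
of the nodes and a bijection of the edges, which preserves balance and imbalance of circles. -/
structure IsIso {N' E' : Type*} (Ω : GraphWithCircles N E) (Ω' : GraphWithCircles N' E')
    (fN : N → N') (fE : E → E') : Prop where
  bijective_nodes : Function.Bijective fN
  bijective_edges : Function.Bijective fE
  ends_map : ∀ e, Ω'.ends (fE e) = (Ω.ends e).map fN
  balanced_iff : ∀ C, Ω.IsCircle C → (C ∈ Ω.balanced ↔ fE '' C ∈ Ω'.balanced)

end GraphWithCircles

/-- `f` is an isomorphism from the matroid `M` to the matroid `M'`: a bijection of the ground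
sets which preserves independence and dependence. -/
def IsMatroidIso {α β : Type*} (f : α → β) (M : Matroid α) (M' : Matroid β) : Prop :=
  Set.BijOn f M.E M'.E ∧ ∀ I ⊆ M.E, M.Indep I ↔ M'.Indep (f '' I)

/-! ### Gain graphs -/

/-- A gain graph with gains in the group `G`: each link `e` with endpoints `v`, `w` has a gain
`gain e v w` in the direction from `v` to `w`, and the gain in the opposite direction is the
inverse. The other values of `gain` have no meaning; half edges have no gains. -/
structure GainGraph (N E G : Type*) [Group G] extends HalfEdgeGraph N E where
  gain : E → N → N → G
  gain_symm : ∀ e v w, v ≠ w → ends e = s(v, w) → gain e w v = (gain e v w)⁻¹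

namespace GainGraph

variable {N E G : Type*} [Group G]

/-- The biased graph `⟨Φ⟩`: a circle is balanced if the product of the gains of its edges, taken
in cyclic order and in a consistent direction, is the identity. (Whether this is so does not depend
on the initial edge and the direction.) -/
def bias (Φ : GainGraph N E G) : GraphWithCircles N E where
  toHalfEdgeGraph := Φ.toHalfEdgeGraph
  balanced := {C | ∃ (n : ℕ) (v : Fin (n + 2) → N) (e : Fin (n + 2) → E),
    Φ.IsCircleSeq v e ∧ C = Set.range e ∧
      (List.ofFn fun i => Φ.gain (e i) (v i) (v (i + 1))).prod = 1}
  isCircle_of_mem := fun _ ⟨n, v, e, h, hC, _⟩ => ⟨n, v, e, h, hC⟩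

end GainGraph

/-! ### Projective dependence, and the synthetic construction -/

section Projective

variable {K V : Type*} [DivisionRing K] [AddCommGroup V] [Module K V]

theorem Projectivization.independent_coe_iff (I : Set (ℙ K V)) :
    Projectivization.Independent (fun x : I => (x : ℙ K V)) ↔
      LinearIndepOn K Projectivization.rep I :=
  Projectivization.independent_iff

/-- `M(A)`, the matroid of projective dependence of the point set `A`. -/
def projectiveMatroid (A : Set (ℙ K V)) : Matroid (ℙ K V) :=
  (IndepMatroid.ofFinitary A
    (fun I => I ⊆ A ∧ Projectivization.Independent (fun x : I => (x : ℙ K V)))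
    ⟨Set.empty_subset _, (Projectivization.independent_coe_iff _).2 (linearIndepOn_empty K _)⟩
    (fun I J hJ hIJ => ⟨hIJ.trans hJ.1, (Projectivization.independent_coe_iff _).2
      (((Projectivization.independent_coe_iff _).1 hJ.2).mono hIJ)⟩)
    (by
      simp only [Projectivization.independent_coe_iff]
      intro I B hI hImax hB
      by_contra hcon
      push Not at hcon
      apply hImax
      have hspan : ∀ b ∈ B, b.rep ∈ Submodule.span K (Projectivization.rep '' I) := by
        intro b hb
        by_cases hbI : b ∈ I
        · exact Submodule.subset_span ⟨b, hbI, rfl⟩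
        · by_contra hbs
          exact hcon b ⟨hb, hbI⟩ (Set.insert_subset (hB.prop.1 hb) hI.1) (hI.2.insert hbs)
      refine ⟨hI, fun J hJ hIJ x hx => ?_⟩
      by_contra hxI
      have hxB : x.rep ∈ Submodule.span K (Projectivization.rep '' B) := by
        by_contra hxB
        have h1 := hB.le_of_ge (y := insert x B)
          ⟨Set.insert_subset (hJ.1 hx) hB.prop.1, hB.prop.2.insert hxB⟩ (Set.subset_insert _ _)
        exact hxB (Submodule.subset_span ⟨x, h1 (Set.mem_insert _ _), rfl⟩)
      have hxs : x.rep ∈ Submodule.span K (Projectivization.rep '' I) := by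
        refine (Submodule.span_le.2 ?_) hxB
        rintro _ ⟨b, hb, rfl⟩
        exact hspan b hb
      exact ((linearIndepOn_insert hxI).1 (hJ.2.mono (Set.insert_subset hx hIJ))).2 hxs)
    (by
      simp only [Projectivization.independent_coe_iff]
      intro I h
      refine ⟨fun x hx => ?_, linearIndepOn_of_finite _ fun t ht hf => (h t ht hf).2⟩
      exact (h {x} (Set.singleton_subset_iff.2 hx) (Set.finite_singleton x)).1 rfl)
    (fun I hI => hI.1)).matroid

/-- The union of all edge lines of `Nh`, i.e. of all lines joining two points of `Nh`. The
degenerate choice `v = w` contributes the point `v` only; it matters only if `Nh` has just one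
point and therefore no edge line at all. -/
def edgeLineUnion (Nh : Set (ℙ K V)) : Set (ℙ K V) :=
  {p | ∃ v w : Nh, p ∈ Projectivization.Subspace.span {(v : ℙ K V), (w : ℙ K V)}}

/-- A cross-flat: a projective flat that contains no point of `Nh`. -/
def IsCrossFlat (Nh : Set (ℙ K V)) (t : Projectivization.Subspace K V) : Prop :=
  Disjoint (t : Set (ℙ K V)) Nh

variable (K V) in
/-- An independent set of points together with a subset of the union of its edge lines: the data
of the synthetic construction. -/
structure FramedPointSet where
  /-- the frame `N̂` -/
  frame : Set (ℙ K V)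
  /-- the point set `Ê` -/
  points : Set (ℙ K V)
  independent : Projectivization.Independent (fun x : frame => (x : ℙ K V))
  subset : points ⊆ edgeLineUnion frame

namespace FramedPointSet

variable (A : FramedPointSet K V)

open Classical in
/-- The underlying graph of `Ω(N̂, Ê)`: its nodes and edges are the elements of `N̂` and of `Ê`.
A point of `Ê ∩ N̂` is a half edge at itself. A point of `Ê \ N̂` is a link, whose endpoints are
the two elements of `N̂` that span the edge line containing the point. -/
noncomputable def graph : HalfEdgeGraph A.frame A.points where
  ends p := if h : (p : ℙ K V) ∈ A.frame then s(⟨p, h⟩, ⟨p, h⟩) else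
    s((A.subset p.2).choose, (A.subset p.2).choose_spec.choose)

/-- The biased graph `Ω(N̂, Ê)`: a circle is balanced if its points lie in a cross-flat. -/
noncomputable def bias : GraphWithCircles A.frame A.points where
  toHalfEdgeGraph := A.graph
  balanced := {C | A.graph.IsCircle C ∧ ∃ t : Projectivization.Subspace K V,
    IsCrossFlat A.frame t ∧ ∀ p ∈ C, (p : ℙ K V) ∈ t}
  isCircle_of_mem := fun _ h => h.1

theorem _root_.Projectivization.rep_mem_of_mem_span {p v w : ℙ K V}
    (h : p ∈ Projectivization.Subspace.span {v, w}) : p.rep ∈ Submodule.span K {v.rep, w.rep} := by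
  have h1 : p ∈ (Submodule.span K {v.rep, w.rep}).projectivization := by
    refine (Projectivization.Subspace.mem_span p).1 h _ ?_
    have key : ∀ q : ℙ K V, q.rep ∈ Submodule.span K {v.rep, w.rep} →
        q ∈ (Submodule.span K {v.rep, w.rep}).projectivization := by
      intro q hq
      rw [← q.mk_rep]
      exact hq
    rintro x (rfl | rfl)
    · exact key _ (Submodule.subset_span (by simp))
    · exact key _ (Submodule.subset_span (by simp))
  rw [← p.mk_rep] at h1
  exact h1

theorem ends_eq_of_mem (p : A.points) (h : (p : ℙ K V) ∈ A.frame) :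
    A.graph.ends p = s(⟨p, h⟩, ⟨p, h⟩) := by
  simp [graph, h]

/-- The endpoints of a link are characterized by its lying on their edge line. -/
theorem ends_eq_of_mem_span (p : A.points) (h : (p : ℙ K V) ∉ A.frame) (v w : A.frame)
    (hp : (p : ℙ K V) ∈ Projectivization.Subspace.span {(v : ℙ K V), (w : ℙ K V)}) :
    v ≠ w ∧ A.graph.ends p = s(v, w) := by
  classical
  have key : ∀ v w : A.frame,
      (p : ℙ K V) ∈ Projectivization.Subspace.span {(v : ℙ K V), (w : ℙ K V)} →
      ∃ f : A.frame →₀ K, v ≠ w ∧ f.support = {v, w} ∧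
        Finsupp.linearCombination K (fun x : A.frame => (x : ℙ K V).rep) f
          = (p : ℙ K V).rep := by
    intro v w hvw
    obtain ⟨a, b, hab⟩ := Submodule.mem_span_pair.1 (Projectivization.rep_mem_of_mem_span hvw)
    have hne : ∀ (u : A.frame) (c : K), (p : ℙ K V).rep ≠ c • (u : ℙ K V).rep := by
      intro u c hc
      apply h
      have : (p : ℙ K V) = u := by
        rw [← (p : ℙ K V).mk_rep, ← (u : ℙ K V).mk_rep, Projectivization.mk_eq_mk_iff']
        exact ⟨c, hc.symm⟩
      exact this ▸ u.2
    have hvw' : v ≠ w := by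
      rintro rfl
      exact hne v (a + b) (by rw [add_smul, hab])
    have ha : a ≠ 0 := by
      rintro rfl
      exact hne w b (by simpa using hab.symm)
    have hb : b ≠ 0 := by
      rintro rfl
      exact hne v a (by simpa using hab.symm)
    refine ⟨Finsupp.single v a + Finsupp.single w b, hvw', ?_, by simpa using hab⟩
    ext x
    by_cases h1 : x = v
    · subst h1; simp [ha, hvw'.symm]
    · by_cases h2 : x = w
      · subst h2; simp [hb, Ne.symm h1]
      · simp [h1, h2]
  obtain ⟨f, hvw, hf, hfp⟩ := key v w hp
  obtain ⟨g, -, hg, hgp⟩ := key _ _ (A.subset p.2).choose_spec.choose_spec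
  have hinj : LinearIndependent K (fun x : A.frame => (x : ℙ K V).rep) :=
    Projectivization.independent_iff.1 A.independent
  have hfg : f = g := hinj (hfp.trans hgp.symm)
  refine ⟨hvw, ?_⟩
  rw [hfg, hg] at hf
  have pair : ∀ x y : A.frame, ({x, y} : Finset A.frame) = {v, w} → s(x, y) = s(v, w) := by
    intro x y hf
    have hx : x ∈ ({v, w} : Finset A.frame) := hf ▸ by simp
    have hy : y ∈ ({v, w} : Finset A.frame) := hf ▸ by simp
    have hv : v ∈ ({x, y} : Finset A.frame) := hf ▸ by simp
    have hw : w ∈ ({x, y} : Finset A.frame) := hf ▸ by simp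
    simp only [Finset.mem_insert, Finset.mem_singleton] at hx hy hv hw
    rw [Sym2.eq_iff]
    grind
  simp only [graph, h, dite_false]
  exact pair _ _ hf

end FramedPointSet

end Projective

/-! ### The analytic construction in `ℙ_N(F)` -/

section Analytic

variable {F N E : Type*} [DivisionRing F]

variable (F) in
/-- The point `v̂ = [0, …, 0, 1_v, 0, …, 0]` of the natural basis of `ℙ_N(F)`. The coordinate
vectors have finite support, so that the points `v̂` form a basis also when `N` is infinite. -/
noncomputable def nodePoint (v : N) : ℙ F (N →₀ F) :=
  Projectivization.mk F (Finsupp.single v 1) (by simp)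

variable (F N) in
/-- The ideal hyperplane `h_∞`, with the equation `∑ v, x v = 0`. -/
noncomputable def idealHyperplane : Projectivization.Subspace F (N →₀ F) :=
  (LinearMap.ker (Finsupp.linearCombination F (fun _ : N => (1 : F)))).projectivization

theorem single_sub_smul_single_ne_zero {v w : N} (h : v ≠ w) (a : F) :
    (Finsupp.single v 1 - a • Finsupp.single w 1 : N →₀ F) ≠ 0 := by
  classical
  intro h0
  have := DFunLike.congr_fun h0 v
  simp [h.symm] at this

open Classical in
/-- The point `ê` of a link `e` with endpoints `v ≠ w` and with gain `a` from `v` to `w`: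
`(1 - a)⁻¹ (v̂ - a ŵ)` if `a ≠ 1`, and the point `[v̂ - ŵ]` in which the line `v̂ŵ` meets the ideal
hyperplane if `a = 1` (see `linkPoint_one`). -/
noncomputable def linkPoint {v w : N} (h : v ≠ w) (a : F) : ℙ F (N →₀ F) :=
  if ha : a ≠ 1 then
    Projectivization.mk F ((1 - a)⁻¹ • (Finsupp.single v 1 - a • Finsupp.single w 1))
      (smul_ne_zero (inv_ne_zero (sub_ne_zero.2 ha.symm)) (single_sub_smul_single_ne_zero h a))
  else Projectivization.mk F (Finsupp.single v 1 - Finsupp.single w 1)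
    (by simpa using single_sub_smul_single_ne_zero h (1 : F))

theorem linkPoint_eq {v w : N} (h : v ≠ w) (a : F) :
    linkPoint h a = Projectivization.mk F (Finsupp.single v 1 - a • Finsupp.single w 1)
      (single_sub_smul_single_ne_zero h a) := by
  unfold linkPoint
  split_ifs with ha
  · rw [Projectivization.mk_eq_mk_iff']
    exact ⟨_, rfl⟩
  · push Not at ha
    subst ha
    simp

theorem linkPoint_mem_span {v w : N} (h : v ≠ w) (a : F) :
    linkPoint h a ∈ Projectivization.Subspace.span {nodePoint F v, nodePoint F w} := by
  rw [linkPoint_eq, Projectivization.Subspace.mem_span]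
  intro W hW
  have hv : nodePoint F v ∈ W := hW (by simp)
  have hw : nodePoint F w ∈ W := hW (by simp)
  rw [nodePoint, ← Projectivization.Subspace.mem_submodule_iff] at hv hw
  rw [← Projectivization.Subspace.mem_submodule_iff]
  exact Submodule.sub_mem _ hv (Submodule.smul_mem _ _ hw)

/-- The line through two node points consists of the points `[a v̂ + b ŵ]`. -/
theorem exists_of_mem_span_nodePoint {v w : N} {x : N →₀ F} {hx : x ≠ 0}
    (h : Projectivization.mk F x hx ∈
      Projectivization.Subspace.span {nodePoint F v, nodePoint F w}) :
    ∃ a b : F, x = Finsupp.single v a + Finsupp.single w b := by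
  have h1 : Projectivization.mk F x hx ∈ (Submodule.span F
      {(Finsupp.single v 1 : N →₀ F), Finsupp.single w 1}).projectivization := by
    refine (Projectivization.Subspace.mem_span _).1 h _ ?_
    rintro y (rfl | rfl)
    · exact Submodule.subset_span (by simp)
    · exact Submodule.subset_span (by simp)
  obtain ⟨a, b, hab⟩ := Submodule.mem_span_pair.1
    ((Submodule.mk_mem_projectivization_iff _ hx).1 h1)
  exact ⟨a, b, by simpa using hab.symm⟩

/-- For gain `1` the point of a link is the meet of the ideal hyperplane and the edge line. -/
theorem linkPoint_one {v w : N} (h : v ≠ w) :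
    ((idealHyperplane F N ⊓ Projectivization.Subspace.span {nodePoint F v, nodePoint F w} :
      Projectivization.Subspace F (N →₀ F)) : Set (ℙ F (N →₀ F))) = {linkPoint h 1} := by
  ext p
  rw [Set.mem_singleton_iff]
  constructor
  · rintro ⟨h1, h2⟩
    induction p with | h x hx =>
    obtain ⟨a, b, rfl⟩ := exists_of_mem_span_nodePoint h2
    have h3 : a + b = 0 := by
      have h4 : Finsupp.single v a + Finsupp.single w b ∈
        LinearMap.ker (Finsupp.linearCombination F (fun _ : N => (1 : F))) := h1
      simpa using h4
    rw [linkPoint_eq, Projectivization.mk_eq_mk_iff']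
    refine ⟨a, ?_⟩
    rw [eq_neg_of_add_eq_zero_right h3]
    simp [sub_eq_add_neg]
  · rintro rfl
    refine ⟨?_, linkPoint_mem_span h 1⟩
    rw [linkPoint_eq]
    change _ ∈ LinearMap.ker (Finsupp.linearCombination F (fun _ : N => (1 : F)))
    simp

theorem linkPoint_symm {v w : N} (h : v ≠ w) (a : Fˣ) :
    linkPoint h.symm ((a⁻¹ : Fˣ) : F) = linkPoint h (a : F) := by
  rw [linkPoint_eq, linkPoint_eq, Projectivization.mk_eq_mk_iff']
  exact ⟨-((a⁻¹ : Fˣ) : F), by simp [sub_eq_add_neg, add_comm]⟩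

namespace GainGraph

variable (Φ : GainGraph N E Fˣ)

open Classical in
/-- The point `ê` of an edge `e`. It does not depend on the direction in which a link is read,
see `edgePoint_link`. -/
noncomputable def edgePoint (e : E) : ℙ F (N →₀ F) :=
  if h : (Φ.ends e).out.1 ≠ (Φ.ends e).out.2 then
    linkPoint h (Φ.gain e (Φ.ends e).out.1 (Φ.ends e).out.2 : F)
  else nodePoint F (Φ.ends e).out.1

theorem edgePoint_half {e : E} {v : N} (he : Φ.ends e = s(v, v)) :
    Φ.edgePoint e = nodePoint F v := by
  have h1 : (Φ.ends e).out.1 = v := by simpa [he] using (Φ.ends e).out_fst_mem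
  have h2 : (Φ.ends e).out.2 = v := by simpa [he] using (Φ.ends e).out_snd_mem
  simp [edgePoint, h1, h2]

theorem edgePoint_link {e : E} {v w : N} (h : v ≠ w) (he : Φ.ends e = s(v, w)) :
    Φ.edgePoint e = linkPoint h (Φ.gain e v w : F) := by
  have h0 : s((Φ.ends e).out.1, (Φ.ends e).out.2) = s(v, w) := by
    rw [← he]; exact (Φ.ends e).out_eq
  unfold edgePoint
  generalize (Φ.ends e).out.1 = x at *
  generalize (Φ.ends e).out.2 = y at *
  rcases Sym2.eq_iff.1 h0 with ⟨rfl, rfl⟩ | ⟨rfl, rfl⟩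
  · simp [h]
  · rw [dif_pos h.symm, Φ.gain_symm e _ _ h he, linkPoint_symm h]

theorem edgePoint_mem (e : E) :
    Φ.edgePoint e ∈ edgeLineUnion (Set.range (nodePoint F : N → ℙ F (N →₀ F))) := by
  induction hz : Φ.ends e with | h v w =>
  refine ⟨⟨_, v, rfl⟩, ⟨_, w, rfl⟩, ?_⟩
  by_cases h : v = w
  · subst h
    rw [Φ.edgePoint_half hz]
    exact Projectivization.Subspace.subset_span _ (by simp)
  · rw [Φ.edgePoint_link h hz]
    exact linkPoint_mem_span h _

/-- The analytic Menelæan point set `ℳ[Φ] = {ê : e ∈ E}`, together with the natural basis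
`N̂ = {v̂ : v ∈ N}` of `ℙ_N(F)` as its frame. -/
noncomputable def menelaean : FramedPointSet F (N →₀ F) where
  frame := Set.range (nodePoint F)
  points := Set.range Φ.edgePoint
  independent := by
    have h : Projectivization.Independent (nodePoint F : N → ℙ F (N →₀ F)) :=
      Projectivization.Independent.mk _ _ (Finsupp.linearIndependent_single_one F N)
    rw [Projectivization.independent_iff] at h ⊢
    exact h.comp (fun x : Set.range (nodePoint F : N → ℙ F (N →₀ F)) => x.2.choose)
      (fun x y hxy => Subtype.ext (by
        rw [← x.2.choose_spec, ← y.2.choose_spec]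
        exact congrArg _ hxy)) |> fun h' => by
          convert h' using 1
          funext x
          simp [x.2.choose_spec]
  subset := by
    rintro _ ⟨e, rfl⟩
    exact Φ.edgePoint_mem e

/-- The mapping `v ↦ v̂` from the nodes of `Φ` to the nodes of `Ω(ℳ[Φ])`. -/
noncomputable def nodeMap (v : N) : Φ.menelaean.frame := ⟨nodePoint F v, v, rfl⟩

/-- The mapping `e ↦ ê` from the edges of `Φ` to the edges of `Ω(ℳ[Φ])`. -/
noncomputable def edgeMap (e : E) : Φ.menelaean.points := ⟨Φ.edgePoint e, e, rfl⟩

end GainGraph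

end Analytic

/-! Everything is read off from the left linear map `boundary`, which sends an edge to a
representative of its point. Up to a nonzero scalar a link from v to w with gain φ goes to v̂ - φŵ,
and a half edge at v goes to v̂. Telescoping along a simple path from u to w with gain g gives one
combination with full support and boundary û - gŵ, and the coefficients are forced by the values at
all nodes but the last (`GainPath.exists_combination`). Closing the path to a circle with gain g
turns the boundary into (1 - g)û (`Closed.exists_combination`). A balanced circle therefore carries
a relation, unique up to scalars and with full support, whereas the points of an unbalanced circle
are independent and span every node of the circle.

Hence every frame circuit carries a unique relation with full support
(`hasUniqueRelation_of_isFrameCircuit`). Two unbalanced figures, possibly with a connecting path,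
express the same node vector in two ways. In a theta graph the three path combinations are subject
to two linear equations, whose solution has no zero coefficient when the three gains are distinct.
Conversely, in the support of a relation no node lies on just one edge. A path on a maximal node set
can then be continued at both ends by edges that return to it, and this forces a frame circuit
(`exists_isFrameCircuit`). So the frame circuits are exactly the minimal dependent sets.

Balance corresponds to cross-flats. Weights on the nodes that switch all gains of a balanced circle
to 1 define a hyperplane through its points that avoids N̂ (`exists_isCrossFlat_of_balanced`). A
flat through the points of an unbalanced circle contains a node. Simplicity of the frame matroid
enters only through injectivity of e ↦ ê. -/

namespace HalfEdgeGraph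

variable {N E : Type*} {Γ : HalfEdgeGraph N E}

theorem nodes_mono {S T : Set E} (h : S ⊆ T) : Γ.nodes S ⊆ Γ.nodes T :=
  fun _ ⟨e, he, hv⟩ => ⟨e, h he, hv⟩

theorem nodes_union (S T : Set E) : Γ.nodes (S ∪ T) = Γ.nodes S ∪ Γ.nodes T := by
  ext v
  simp only [nodes, Set.mem_union, Set.mem_ofPred_eq]
  grind

end HalfEdgeGraph

/-! ### Simple paths and circles with their gains. -/

namespace GainGraph

variable {N E G : Type*} [Group G] (Φ : GainGraph N E G)

/-- `Φ.GainPath P U u w g`: there is a simple path from `u` to `w` with edge set `P`, node set `U`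
and gain `g`. -/
inductive GainPath : Set E → Set N → N → N → G → Prop
  | nil (u : N) : GainPath ∅ {u} u u 1
  | cons {P : Set E} {U : Set N} {u v w : N} {g : G} (e : E) (he : Φ.ends e = s(u, v))
      (hu : u ∉ U) (h : GainPath P U v w g) :
      GainPath (insert e P) (insert u U) u w (Φ.gain e u v * g)

namespace GainPath

variable {Φ} {P Q : Set E} {U W : Set N} {u v w x : N} {g h : G}

theorem start_mem (p : Φ.GainPath P U u w g) : u ∈ U := by
  cases p <;> simp

theorem end_mem (p : Φ.GainPath P U u w g) : w ∈ U := by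
  induction p with
  | nil => simp
  | cons e he hu p ih => exact Or.inr ih

theorem mem_of_mem_ends (p : Φ.GainPath P U u w g) {e : E} (he : e ∈ P) {z : N}
    (hz : z ∈ Φ.ends e) : z ∈ U := by
  induction p with
  | nil => simp at he
  | cons f hf hu p ih =>
    rcases he with rfl | he
    · rw [hf, Sym2.mem_iff] at hz
      rcases hz with rfl | rfl
      · simp
      · exact Or.inr p.start_mem
    · exact Or.inr (ih he)

theorem nodes_subset (p : Φ.GainPath P U u w g) : Φ.nodes P ⊆ U :=
  fun _ ⟨_, he, hv⟩ => p.mem_of_mem_ends he hv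

theorem not_isDiag (p : Φ.GainPath P U u w g) {e : E} (he : e ∈ P) : ¬ (Φ.ends e).IsDiag := by
  induction p with
  | nil => simp at he
  | cons f hf hu p ih =>
    rcases he with rfl | he
    · rw [hf, Sym2.mk_isDiag_iff]
      rintro rfl
      exact hu p.start_mem
    · exact ih he

theorem eq_nil (p : Φ.GainPath P U u u g) : P = ∅ ∧ U = {u} ∧ g = 1 := by
  cases p with
  | nil => simp
  | cons e he hu p => exact absurd p.end_mem hu

/-- The trivial path has a node but no edge, which is why its ends must differ here. -/
theorem nodes_eq (p : Φ.GainPath P U u w g) (huw : u ≠ w) : Φ.nodes P = U := by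
  refine p.nodes_subset.antisymm ?_
  induction p with
  | nil => exact absurd rfl huw
  | @cons P U u v w g e he hu p ih =>
    have h1 : ∀ z ∈ Φ.ends e, z ∈ Φ.nodes (insert e P) := fun z hz => ⟨e, by simp, hz⟩
    by_cases hvw : v = w
    · subst hvw
      obtain ⟨rfl, rfl, -⟩ := p.eq_nil
      rintro z (rfl | rfl) <;> exact h1 _ (by simp [he])
    · rintro z (rfl | hz)
      · exact h1 _ (by simp [he])
      · exact HalfEdgeGraph.nodes_mono (Set.subset_insert _ _) (ih hvw hz)

/-- A common edge would have all its endpoints equal to `x`, but a path contains no half edge. -/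
theorem disjoint_edges (p : Φ.GainPath P U u w g) (hQ : Φ.nodes Q ⊆ W)
    (hUW : U ∩ W ⊆ {x}) : Disjoint P Q := by
  rw [Set.disjoint_left]
  intro e he he'
  refine p.not_isDiag he ?_
  induction hz : Φ.ends e with | h a b =>
  have ha : a = x := hUW ⟨p.mem_of_mem_ends he (by simp [hz]), hQ ⟨e, he', by simp [hz]⟩⟩
  have hb : b = x := hUW ⟨p.mem_of_mem_ends he (by simp [hz]), hQ ⟨e, he', by simp [hz]⟩⟩
  rw [Sym2.mk_isDiag_iff, ha, hb]

theorem single {e : E} (he : Φ.ends e = s(u, v)) (huv : u ≠ v) :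
    Φ.GainPath {e} {u, v} u v (Φ.gain e u v) := by
  have := cons e he (by simpa using huv) (nil (Φ := Φ) v)
  simpa using this

theorem append (p : Φ.GainPath P U u v g) (q : Φ.GainPath Q W v w h) (hUW : U ∩ W ⊆ {v}) :
    Φ.GainPath (P ∪ Q) (U ∪ W) u w (g * h) := by
  induction p with
  | nil u =>
    have : insert u W = W := Set.insert_eq_of_mem q.start_mem
    simpa [this] using q
  | @cons P U u v' v g e he hu p ih =>
    have hu' : u ∉ U ∪ W := by
      rintro (h1 | h1)
      · exact hu h1
      · have : u = v := hUW ⟨by simp, h1⟩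
        exact hu (this ▸ p.end_mem)
    have := cons e he hu' (ih q fun z hz => hUW ⟨Or.inr hz.1, hz.2⟩)
    rwa [Set.insert_union, Set.insert_union, mul_assoc]

theorem reverse (p : Φ.GainPath P U u w g) : Φ.GainPath P U w u g⁻¹ := by
  induction p with
  | nil u => simpa using nil u
  | @cons P U u v w g e he hu p ih =>
    have huv : u ≠ v := by rintro rfl; exact hu p.start_mem
    have h1 := ih.append (single (he.trans Sym2.eq_swap) huv.symm) (by
      rintro z ⟨hz, rfl | rfl⟩
      · rfl
      · exact absurd hz hu)
    have h2 : U ∪ {v, u} = insert u U := by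
      ext z
      have := p.start_mem
      simp only [Set.mem_union, Set.mem_insert_iff, Set.mem_singleton_iff]
      grind
    rwa [h2, Φ.gain_symm e u v huv he, ← mul_inv_rev, Set.union_singleton] at h1

/-- A path can be split at any of its nodes. -/
theorem split (p : Φ.GainPath P U u w g) (hx : x ∈ U) :
    ∃ P₁ U₁ g₁ P₂ U₂ g₂, Φ.GainPath P₁ U₁ u x g₁ ∧ Φ.GainPath P₂ U₂ x w g₂ ∧
      P = P₁ ∪ P₂ ∧ U = U₁ ∪ U₂ ∧ U₁ ∩ U₂ ⊆ {x} := by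
  induction p with
  | nil u =>
    obtain rfl : x = u := hx
    exact ⟨_, _, _, _, _, _, nil x, nil x, by simp, by simp, by simp⟩
  | @cons P U u v w g e he hu p ih =>
    by_cases hxu : x = u
    · subst hxu
      refine ⟨_, _, _, _, _, _, nil x, cons e he hu p, by simp, by simp, by simp⟩
    · obtain ⟨P₁, U₁, g₁, P₂, U₂, g₂, p₁, p₂, rfl, rfl, hU⟩ := ih (hx.resolve_left hxu)
      have hu' : u ∉ U₁ := fun h => hu (Or.inl h)
      refine ⟨_, _, _, _, _, _, cons e he hu' p₁, p₂, (Set.insert_union).symm,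
        (Set.insert_union).symm, ?_⟩
      rintro z ⟨rfl | hz, hz'⟩
      · exact absurd (Or.inr hz') hu
      · exact hU ⟨hz, hz'⟩

theorem ofSeq {n : ℕ} (v : Fin (n + 1) → N) (e : Fin n → E) (hv : Function.Injective v)
    (he : ∀ i, Φ.ends (e i) = s(v i.castSucc, v i.succ)) :
    Φ.GainPath (Set.range e) (Set.range v) (v 0) (v (Fin.last n))
      (List.ofFn fun i => Φ.gain (e i) (v i.castSucc) (v i.succ)).prod := by
  induction n with
  | zero =>
    have h1 : Set.range v = {v 0} := by
      ext z; simp [Fin.exists_fin_one, eq_comm]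
    have h2 : Set.range e = ∅ := Set.range_eq_empty e
    rw [h1, h2]
    simpa using nil (Φ := Φ) (v 0)
  | succ n ih =>
    have h1 := ih (Fin.tail v) (Fin.tail e) (hv.comp (Fin.succ_injective _))
      (fun i => by simpa [Fin.tail] using he i.succ)
    have h2 : v 0 ∉ Set.range (Fin.tail v) := by
      rintro ⟨i, hi⟩
      exact Fin.succ_ne_zero i (hv hi)
    have h3 := cons (e 0) (by simpa [Fin.tail] using he 0) h2 h1
    have h4 : insert (e 0) (Set.range (Fin.tail e)) = Set.range e := by
      rw [← Fin.range_cons, Fin.cons_self_tail]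
    have h5 : insert (v 0) (Set.range (Fin.tail v)) = Set.range v := by
      rw [← Fin.range_cons, Fin.cons_self_tail]
    rw [h4, h5] at h3
    rw [List.ofFn_succ, List.prod_cons]
    exact h3

theorem exists_seq (p : Φ.GainPath P U u w g) : ∃ (n : ℕ) (v : Fin (n + 1) → N) (e : Fin n → E),
    Function.Injective v ∧ Function.Injective e ∧ v 0 = u ∧ v (Fin.last n) = w ∧
    (∀ i, Φ.ends (e i) = s(v i.castSucc, v i.succ)) ∧ P = Set.range e ∧ U = Set.range v ∧
    (List.ofFn fun i => Φ.gain (e i) (v i.castSucc) (v i.succ)).prod = g := by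
  induction p with
  | nil u =>
    refine ⟨0, fun _ => u, Fin.elim0, fun i j _ => Subsingleton.elim (α := Fin 1) i j,
      Function.injective_of_subsingleton _, rfl, rfl, fun i => i.elim0, ?_, ?_, by simp⟩
    · exact (Set.range_eq_empty _).symm
    · simp
  | @cons P U u v' w g f hf hu p ih =>
    obtain ⟨n, v, e, hv, he, rfl, rfl, hends, rfl, rfl, rfl⟩ := ih
    refine ⟨n + 1, Fin.cons u v, Fin.cons f e, Fin.cons_injective_iff.2 ⟨hu, hv⟩,
      Fin.cons_injective_iff.2 ⟨?_, he⟩, by simp, ?_, ?_, ?_, ?_, ?_⟩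
    · rintro h1
      exact hu (p.mem_of_mem_ends h1 (by simp [hf]))
    · rw [← Fin.succ_last, Fin.cons_succ]
    · intro i
      refine Fin.cases ?_ (fun i => ?_) i
      · simpa using hf
      · simpa using hends i
    · rw [Fin.range_cons]
    · rw [Fin.range_cons]
    · rw [List.ofFn_succ, List.prod_cons]
      simp

theorem isPath (p : Φ.GainPath P U u w g) : Φ.IsPath P u w := by
  obtain ⟨n, v, e, hv, -, h0, h1, he, hP, -⟩ := p.exists_seq
  exact ⟨n, v, e, hv, h0, h1, he, hP⟩

theorem of_isPath (h : Φ.IsPath P u w) : ∃ U g, Φ.GainPath P U u w g := by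
  obtain ⟨n, v, e, hv, rfl, rfl, he, rfl⟩ := h
  exact ⟨_, _, ofSeq v e hv he⟩

end GainPath

/-- `Φ.Closed C U u w g`: `C` consists of a simple path from `u` to `w` with node set `U` and an edge
from `w` back to `u`, and `g` is the total gain. If `u = w` then `C` is a half edge, otherwise it is
a circle. -/
def Closed (C : Set E) (U : Set N) (u w : N) (g : G) : Prop :=
  ∃ P e k, Φ.GainPath P U u w k ∧ e ∉ P ∧ Φ.ends e = s(w, u) ∧ C = insert e P ∧
    g = k * Φ.gain e w u

variable {Φ}

/-- The cyclic sequence is cut at its last edge, whose index wraps around to 0; the other edges form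
a path through all the nodes. -/
theorem closed_of_isCircleSeq {n : ℕ} {v : Fin (n + 2) → N} {e : Fin (n + 2) → E}
    (h : Φ.IsCircleSeq v e) : v 0 ≠ v (Fin.last _) ∧
    Φ.Closed (Set.range e) (Set.range v) (v 0) (v (Fin.last _))
      (List.ofFn fun i => Φ.gain (e i) (v i) (v (i + 1))).prod := by
  obtain ⟨hv, he, hends⟩ := h
  refine ⟨fun h => Fin.last_pos.ne (hv h), _, e (Fin.last _), _,
    GainPath.ofSeq v (fun i => e i.castSucc) hv (fun i => ?_), ?_, ?_, ?_, ?_⟩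
  · rw [hends, Fin.coeSucc_eq_succ]
  · rintro ⟨i, hi⟩
    exact (Fin.castSucc_lt_last i).ne (he hi)
  · rw [hends, Fin.last_add_one]
  · ext f
    simp only [Set.mem_range, Set.mem_insert_iff, Fin.exists_fin_succ']
    grind
  · rw [List.ofFn_succ', List.concat_eq_append, List.prod_append]
    simp

theorem Closed.exists_seq {C : Set E} {U : Set N} {u w : N} {g : G} (h : Φ.Closed C U u w g)
    (huw : u ≠ w) : ∃ (n : ℕ) (v : Fin (n + 2) → N) (e : Fin (n + 2) → E),
    Φ.IsCircleSeq v e ∧ C = Set.range e ∧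
      (List.ofFn fun i => Φ.gain (e i) (v i) (v (i + 1))).prod = g := by
  obtain ⟨P, f, k, p, hf, hends, rfl, rfl⟩ := h
  obtain ⟨n, v, e, hv, he, rfl, rfl, hends', rfl, rfl, rfl⟩ := p.exists_seq
  cases n with
  | zero => exact absurd rfl huw
  | succ n =>
    refine ⟨n, v, Fin.snoc e f, ⟨hv, ?_, ?_⟩, ?_, ?_⟩
    · rw [Fin.snoc_injective_iff]
      exact ⟨he, hf⟩
    · intro i
      refine Fin.lastCases ?_ (fun i => ?_) i
      · simpa using hends
      · simpa using hends' i
    · rw [Fin.range_snoc]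
    · rw [List.ofFn_succ', List.concat_eq_append, List.prod_append]
      simp

theorem Closed.isCircle {C : Set E} {U : Set N} {u w : N} {g : G} (h : Φ.Closed C U u w g)
    (huw : u ≠ w) : Φ.IsCircle C := by
  obtain ⟨n, v, e, h1, h2, -⟩ := h.exists_seq huw
  exact ⟨n, v, e, h1, h2⟩

theorem Closed.balanced {C : Set E} {U : Set N} {u w : N} (h : Φ.Closed C U u w 1)
    (huw : u ≠ w) : C ∈ Φ.bias.balanced := by
  obtain ⟨n, v, e, h1, h2, h3⟩ := h.exists_seq huw
  exact ⟨n, v, e, h1, h2, h3⟩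

theorem closed_of_isCircle {C : Set E} (h : Φ.IsCircle C) :
    ∃ U u w g, u ≠ w ∧ Φ.Closed C U u w g := by
  obtain ⟨n, v, e, h, rfl⟩ := h
  exact ⟨_, _, _, _, closed_of_isCircleSeq h⟩

theorem closed_of_balanced {C : Set E} (h : C ∈ Φ.bias.balanced) :
    ∃ U u w, u ≠ w ∧ Φ.Closed C U u w 1 := by
  obtain ⟨n, v, e, h, rfl, hg⟩ := h
  have := closed_of_isCircleSeq h
  exact ⟨_, _, _, this.1, hg ▸ this.2⟩

theorem Closed.nodes_eq {C : Set E} {U : Set N} {u w : N} {g : G} (h : Φ.Closed C U u w g) :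
    Φ.nodes C = U := by
  obtain ⟨P, f, k, p, hf, hends, rfl, rfl⟩ := h
  have h1 : Φ.nodes (insert f P) = Φ.nodes {f} ∪ Φ.nodes P := by
    rw [Set.insert_eq, HalfEdgeGraph.nodes_union]
  have h2 : Φ.nodes {f} = {w, u} := by
    ext z; simp [HalfEdgeGraph.nodes, hends]
  rw [h1, h2]
  by_cases huw : u = w
  · subst huw
    obtain ⟨rfl, rfl, -⟩ := p.eq_nil
    ext z; simp [HalfEdgeGraph.nodes]
  · rw [p.nodes_eq huw]
    refine Set.union_eq_right.2 ?_
    rintro z (rfl | rfl)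
    · exact p.end_mem
    · exact p.start_mem

theorem Closed.balanced_or_isUnbalancedFigure {C : Set E} {U : Set N} {u w : N} {g : G}
    (h : Φ.Closed C U u w g) : C ∈ Φ.bias.balanced ∨ Φ.bias.IsUnbalancedFigure C := by
  by_cases huw : u = w
  · subst huw
    obtain ⟨P, f, k, p, hf, hends, rfl, rfl⟩ := h
    obtain ⟨rfl, rfl, -⟩ := p.eq_nil
    exact Or.inr (Or.inl ⟨f, u, hends, by simp⟩)
  · by_cases hC : C ∈ Φ.bias.balanced
    · exact Or.inl hC
    · exact Or.inr (Or.inr ⟨h.isCircle huw, hC⟩)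

/-- A closed path can be started in any of its nodes. -/
theorem Closed.rotate {C : Set E} {U : Set N} {u w x : N} {g : G} (h : Φ.Closed C U u w g)
    (huw : u ≠ w) (hx : x ∈ U) : ∃ w' g', x ≠ w' ∧ Φ.Closed C U x w' g' := by
  by_cases hxu : x = u
  · subst hxu
    exact ⟨w, g, huw, h⟩
  obtain ⟨P, f, k, p, hf, hends, rfl, rfl⟩ := h
  obtain ⟨P₁, U₁, g₁, P₂, U₂, g₂, p₁, p₂, rfl, rfl, hU⟩ := p.split hx
  -- Read backwards from `x`, the first part begins with an edge `e`, which becomes the new closing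
  -- edge. The new path runs from `x` to `w`, over `f` to `u`, and along the rest of the first part
  -- to the other end of `e`. Its gain is left unspecified, since balance can be read from `C`
  -- itself.
  obtain ⟨g', q'⟩ : ∃ g', Φ.GainPath P₁ U₁ x u g' := ⟨_, p₁.reverse⟩
  cases q' with
  | nil => exact absurd rfl hxu
  | @cons Q W _ y _ _ e he hxW q =>
    have hw : w ∉ W := fun hw => by
      have : w = x := hU ⟨Or.inr hw, p₂.end_mem⟩
      exact hxW (this ▸ hw)
    have hq' := p₂.append (.cons f hends hw q.reverse) (by
      rintro z ⟨hz, rfl | hz'⟩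
      · rfl
      · have : z = x := hU ⟨Or.inr hz', hz⟩
        exact absurd (this ▸ hz') hxW)
    have hU' : U₂ ∪ insert w W = insert x W ∪ U₂ := by
      have h1 := p₂.end_mem
      have h2 := p₂.start_mem
      ext z
      simp only [Set.mem_union, Set.mem_insert_iff]
      grind
    refine ⟨y, _, ?_, _, e, _, hU' ▸ hq', ?_, ?_, ?_, rfl⟩
    · rintro rfl
      exact hxW q.start_mem
    · have h1 : e ∉ Q := fun h => hxW (q.mem_of_mem_ends h (by simp [he]))
      have h2 : e ∉ P₂ :=
        Set.disjoint_left.1 (p₁.disjoint_edges p₂.nodes_subset hU) (Set.mem_insert _ _)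
      have h3 : e ≠ f := by rintro rfl; simp at hf
      simp [h1, h2, h3]
    · rw [he, Sym2.eq_swap]
    · ext z
      simp only [Set.mem_union, Set.mem_insert_iff]
      grind

/-- The first edge of the second path serves as the closing edge. The total gain is then a conjugate
of h * g⁻¹, so only its being 1 is recorded. -/
theorem exists_closed_of_paths {P Q : Set E} {U W : Set N} {u w : N} {g h : G}
    (p : Φ.GainPath P U u w g) (q : Φ.GainPath Q W u w h) (huw : u ≠ w) (hPQ : Disjoint P Q)
    (hUW : U ∩ W ⊆ {u, w}) :
    ∃ x y k, x ≠ y ∧ Φ.Closed (P ∪ Q) (U ∪ W) x y k ∧ (k = 1 ↔ g = h) := by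
  cases q with
  | nil => exact absurd rfl huw
  | @cons Q W _ v _ h e he hu q =>
    have := q.append p.reverse (by
      rintro z ⟨hz, hz'⟩
      rcases hUW ⟨hz', Or.inr hz⟩ with rfl | rfl
      · exact absurd hz hu
      · rfl)
    have hU' : U ∪ insert u W = W ∪ U := by
      have h1 := p.start_mem
      ext z
      simp only [Set.mem_union, Set.mem_insert_iff]
      grind
    refine ⟨v, u, h * g⁻¹ * Φ.gain e u v, ?_, ⟨_, e, _, hU' ▸ this, ?_, he, ?_, rfl⟩, ?_⟩
    · rintro rfl
      exact hu q.start_mem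
    · rintro (h1 | h1)
      · exact hu (q.mem_of_mem_ends h1 (by simp [he]))
      · exact Set.disjoint_left.1 hPQ h1 (by simp)
    · ext z
      simp only [Set.mem_union, Set.mem_insert_iff]
      grind
    · rw [mul_assoc, mul_eq_one_iff_eq_inv, mul_inv_rev, inv_inv, eq_inv_mul_iff_mul_eq]
      exact eq_comm

/-- A path with two further edges, one at each end, that join the ends to nodes of the path
contains a frame circuit. -/
theorem GainPath.exists_isFrameCircuit {P : Set E} {U : Set N} {u w x y : N} {g : G} {e f : E}
    (p : Φ.GainPath P U u w g) (he : Φ.ends e = s(u, y)) (hy : y ∈ U) (heP : e ∉ P)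
    (hf : Φ.ends f = s(w, x)) (hx : x ∈ U) (hfP : f ∉ P) (hef : e ≠ f) :
    ∃ C ⊆ insert e (insert f P), Φ.bias.IsFrameCircuit C := by
  obtain ⟨P₁, U₁, g₁, P₂, U₂, g₂, p₁, p₂, rfl, rfl, hU⟩ := p.split hx
  simp only [Set.mem_union, not_or] at heP hfP
  -- If `y` does not come after `x` on the path, `e` closes the initial part up to `y` and `f`
  -- closes the final part from `x`. The two figures share the node `x = y` or are joined by the
  -- middle part `M`.
  by_cases hy₁ : y ∈ U₁
  · obtain ⟨Q, V₁, h₁, M, V₂, h₂, q, m, rfl, rfl, hV⟩ := p₁.split hy₁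
    simp only [Set.mem_union, not_or] at heP hfP
    have hA : Φ.Closed (insert e Q) V₁ y u _ := ⟨_, e, _, q.reverse, heP.1.1, he, rfl, rfl⟩
    have hB : Φ.Closed (insert f P₂) U₂ x w _ := ⟨_, f, _, p₂, hfP.2, hf, rfl, rfl⟩
    have hAs : insert e Q ⊆ insert e (insert f (Q ∪ M ∪ P₂)) := by
      intro z; simp only [Set.mem_union, Set.mem_insert_iff]; tauto
    have hBs : insert f P₂ ⊆ insert e (insert f (Q ∪ M ∪ P₂)) := by
      intro z; simp only [Set.mem_union, Set.mem_insert_iff]; tauto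
    rcases hA.balanced_or_isUnbalancedFigure with hA' | hA'
    · exact ⟨_, hAs, Or.inl hA'⟩
    rcases hB.balanced_or_isUnbalancedFigure with hB' | hB'
    · exact ⟨_, hBs, Or.inl hB'⟩
    by_cases hyx : y = x
    · subst hyx
      refine ⟨_, Set.union_subset hAs hBs,
        Or.inr (Or.inr (Or.inl ⟨_, _, y, hA', hB', ?_, ?_, rfl⟩))⟩
      · have h1 := Set.disjoint_left.1 (q.disjoint_edges (x := y) p₂.nodes_subset
          fun z hz => hU ⟨Or.inl hz.1, hz.2⟩)
        rw [Set.disjoint_left]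
        rintro z (rfl | hz) (rfl | hz')
        · exact hef rfl
        · exact heP.2 hz'
        · exact hfP.1.1 hz
        · exact h1 hz hz'
      · refine (congrArg₂ _ hA.nodes_eq hB.nodes_eq).trans ?_
        refine subset_antisymm (fun z hz => hU ⟨Or.inl hz.1, hz.2⟩) ?_
        rintro z rfl
        exact ⟨q.end_mem, p₂.start_mem⟩
    · refine ⟨insert e Q ∪ M ∪ insert f P₂, Set.union_subset (Set.union_subset hAs ?_) hBs,
        Or.inr (Or.inr (Or.inr ⟨_, _, M, y, x, hA', hB', ?_, m.isPath, ?_, ?_, rfl⟩))⟩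
      · intro z; simp only [Set.mem_union, Set.mem_insert_iff]; tauto
      · change Disjoint (Φ.nodes _) (Φ.nodes _)
        rw [hA.nodes_eq, hB.nodes_eq, Set.disjoint_left]
        intro z hz hz'
        have hzx : z = x := hU ⟨Or.inl hz, hz'⟩
        subst hzx
        exact hyx (hV ⟨hz, m.end_mem⟩).symm
      · refine (congrArg₂ _ (m.nodes_eq hyx) hA.nodes_eq).trans ?_
        refine subset_antisymm (fun z hz => hV ⟨hz.2, hz.1⟩) ?_
        rintro z rfl
        exact ⟨m.start_mem, q.end_mem⟩
      · refine (congrArg₂ _ (m.nodes_eq hyx) hB.nodes_eq).trans ?_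
        refine subset_antisymm (fun z hz => hU ⟨Or.inr hz.1, hz.2⟩) ?_
        rintro z rfl
        exact ⟨m.end_mem, p₂.start_mem⟩
  -- If `y` comes after `x`, the two edges cross. The nodes `x` and `y` are joined by the middle
  -- part, by the initial part backwards followed by `e`, and by `f` followed by the final part
  -- backwards: a theta graph.
  · have hy₂ := hy.resolve_left hy₁
    have hxy : x ≠ y := by rintro rfl; exact hy₁ p₁.end_mem
    obtain ⟨M, V₁, h₁, R, V₂, h₂, m, r, rfl, rfl, hV⟩ := p₂.split hy₂
    simp only [Set.mem_union, not_or] at heP hfP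
    have huy : u ≠ y := by rintro rfl; exact hy₁ p₁.start_mem
    have hxV : x ∉ V₂ := fun h => hxy (hV ⟨m.start_mem, h⟩)
    have s := GainPath.cons f (hf.trans Sym2.eq_swap) hxV r.reverse
    have t := p₁.reverse.append (GainPath.single he huy) (by
      rintro z ⟨hz, rfl | rfl⟩
      · rfl
      · exact absurd hz hy₁)
    have d₁ := Set.disjoint_left.1 (p₁.disjoint_edges (x := x) m.nodes_subset
      fun z hz => hU ⟨hz.1, Or.inl hz.2⟩)
    have d₂ := Set.disjoint_left.1 (p₁.disjoint_edges (x := x) r.nodes_subset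
      fun z hz => hU ⟨hz.1, Or.inr hz.2⟩)
    have d₃ := Set.disjoint_left.1 (m.disjoint_edges r.nodes_subset hV)
    have a₁ := p₁.start_mem
    have a₂ := p₁.end_mem
    have a₃ := m.start_mem
    have a₄ := m.end_mem
    have a₅ := r.start_mem
    have hth : Φ.IsTheta M (P₁ ∪ {e}) (insert f R) := by
      refine ⟨x, y, hxy, m.isPath, t.isPath, s.isPath, ?_, ?_, ?_, ?_, ?_, ?_⟩
      · rw [Set.disjoint_left]
        rintro z hz (hz' | rfl)
        · exact d₁ hz' hz
        · exact heP.2.1 hz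
      · rw [Set.disjoint_left]
        rintro z (hz | rfl) (rfl | hz')
        · exact hfP.1 hz
        · exact d₂ hz hz'
        · exact hef rfl
        · exact heP.2.2 hz'
      · rw [Set.disjoint_left]
        rintro z hz (rfl | hz')
        · exact hfP.2.1 hz
        · exact d₃ hz hz'
      · rw [m.nodes_eq hxy, t.nodes_eq hxy]
        refine subset_antisymm ?_ ?_
        · rintro z ⟨hz, hz' | rfl | rfl⟩
          · exact Or.inl (hU ⟨hz', Or.inl hz⟩)
          · exact Or.inl (hU ⟨a₁, Or.inl hz⟩)
          · exact Or.inr rfl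
        · rintro z (rfl | rfl)
          · exact ⟨a₃, Or.inl a₂⟩
          · exact ⟨a₄, Or.inr (by simp)⟩
      · rw [t.nodes_eq hxy, s.nodes_eq hxy]
        refine subset_antisymm ?_ ?_
        · rintro z ⟨hz' | rfl | rfl, rfl | hz⟩
          · exact Or.inl rfl
          · exact Or.inl (hU ⟨hz', Or.inr hz⟩)
          · exact Or.inl rfl
          · exact Or.inl (hU ⟨a₁, Or.inr hz⟩)
          · exact Or.inl rfl
          · exact Or.inr rfl
        · rintro z (rfl | rfl)
          · exact ⟨Or.inl a₂, Or.inl rfl⟩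
          · exact ⟨Or.inr (by simp), Or.inr a₅⟩
      · rw [m.nodes_eq hxy, s.nodes_eq hxy]
        refine subset_antisymm ?_ ?_
        · rintro z ⟨hz, rfl | hz'⟩
          · exact Or.inl rfl
          · exact Or.inr (hV ⟨hz, hz'⟩)
        · rintro z (rfl | rfl)
          · exact ⟨a₃, Or.inl rfl⟩
          · exact ⟨a₄, Or.inr a₅⟩
    by_cases c₁ : M ∪ (P₁ ∪ {e}) ∈ Φ.bias.balanced
    · refine ⟨_, ?_, Or.inl c₁⟩
      intro z; simp only [Set.mem_union, Set.mem_insert_iff, Set.mem_singleton_iff]; tauto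
    by_cases c₂ : (P₁ ∪ {e}) ∪ insert f R ∈ Φ.bias.balanced
    · refine ⟨_, ?_, Or.inl c₂⟩
      intro z; simp only [Set.mem_union, Set.mem_insert_iff, Set.mem_singleton_iff]; tauto
    by_cases c₃ : M ∪ insert f R ∈ Φ.bias.balanced
    · refine ⟨_, ?_, Or.inl c₃⟩
      intro z; simp only [Set.mem_union, Set.mem_insert_iff]; tauto
    refine ⟨_, ?_, Or.inr (Or.inl ⟨_, _, _, hth, c₁, c₂, c₃, rfl⟩)⟩
    intro z; simp only [Set.mem_union, Set.mem_insert_iff, Set.mem_singleton_iff]; tauto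

end GainGraph

/-! ### Linear relations between the points of paths and circles. -/

namespace GainGraph

variable {F N E : Type*} [DivisionRing F] (Φ : GainGraph N E Fˣ)

/-- The linear combination of representatives of the points `ê`. -/
noncomputable def boundary : (E →₀ F) →ₗ[F] (N →₀ F) :=
  Finsupp.linearCombination F fun e => (Φ.edgePoint e).rep

theorem boundary_single (e : E) (a : F) :
    Φ.boundary (Finsupp.single e a) = a • (Φ.edgePoint e).rep := by
  simp [boundary]

variable {Φ}

/-- The representative `rep` is an arbitrary choice, so it is known only up to a nonzero left scalar
`k`. -/
theorem rep_half {e : E} {v : N} (he : Φ.ends e = s(v, v)) :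
    ∃ k : F, k ≠ 0 ∧ (Φ.edgePoint e).rep = Finsupp.single v k := by
  rw [Φ.edgePoint_half he, nodePoint]
  obtain ⟨k, hk⟩ := Projectivization.exists_smul_eq_mk_rep F (Finsupp.single v (1 : F)) (by simp)
  refine ⟨k, k.ne_zero, ?_⟩
  rw [← hk, Units.smul_def]
  simp

theorem rep_link {e : E} {v w : N} (hvw : v ≠ w) (he : Φ.ends e = s(v, w)) :
    ∃ k : F, k ≠ 0 ∧ (Φ.edgePoint e).rep =
      Finsupp.single v k - Finsupp.single w (k * (Φ.gain e v w : F)) := by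
  rw [Φ.edgePoint_link hvw he, linkPoint_eq]
  obtain ⟨k, hk⟩ := Projectivization.exists_smul_eq_mk_rep F _
    (single_sub_smul_single_ne_zero hvw (Φ.gain e v w : F))
  refine ⟨k, k.ne_zero, ?_⟩
  rw [← hk, Units.smul_def]
  simp [smul_sub]

theorem rep_apply_ne_zero {e : E} {v : N} (h : v ∈ Φ.ends e) : (Φ.edgePoint e).rep v ≠ 0 := by
  obtain ⟨w, hw⟩ := h
  by_cases hvw : v = w
  · subst hvw
    obtain ⟨k, hk, h⟩ := rep_half hw
    simpa [h] using hk
  · obtain ⟨k, hk, h⟩ := rep_link hvw hw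
    simpa [h, Ne.symm hvw] using hk

theorem rep_apply_eq_zero {e : E} {v : N} (h : v ∉ Φ.ends e) : (Φ.edgePoint e).rep v = 0 := by
  induction hz : Φ.ends e with | h a b =>
  have h1 : v ≠ a := by rintro rfl; simp [hz] at h
  have h2 : v ≠ b := by rintro rfl; simp [hz] at h
  by_cases hab : a = b
  · subst hab
    obtain ⟨k, hk, h⟩ := rep_half hz
    simp [h, h1.symm]
  · obtain ⟨k, hk, h⟩ := rep_link hab hz
    simp [h, h1.symm, h2.symm]

theorem boundary_apply (c : E →₀ F) (v : N) :
    Φ.boundary c v = c.sum fun e a => a * (Φ.edgePoint e).rep v := by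
  simp [boundary, Finsupp.linearCombination_apply, Finsupp.sum, Finsupp.finsetSum_apply]

theorem boundary_apply_eq_zero {c : E →₀ F} {S : Set E} (hc : ∀ e ∉ S, c e = 0) {v : N}
    (hv : v ∉ Φ.nodes S) : Φ.boundary c v = 0 := by
  rw [boundary_apply]
  refine Finset.sum_eq_zero fun e he => ?_
  beta_reduce
  rw [rep_apply_eq_zero, mul_zero]
  intro h
  refine hv ⟨e, ?_, h⟩
  by_contra hS
  exact Finsupp.mem_support_iff.1 he (hc e hS)

/-- In a vanishing linear combination every endpoint of an edge lies on a second edge. -/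
theorem exists_ne_of_boundary_eq_zero {c : E →₀ F} (hc : Φ.boundary c = 0) {e : E} (he : c e ≠ 0)
    {v : N} (hv : v ∈ Φ.ends e) : ∃ f, c f ≠ 0 ∧ f ≠ e ∧ v ∈ Φ.ends f := by
  by_contra! hcon
  have h1 : Φ.boundary c v = c e * (Φ.edgePoint e).rep v := by
    rw [boundary_apply]
    refine Finset.sum_eq_single e (fun f hf hfe => ?_) (fun h => ?_)
    · beta_reduce
      rw [rep_apply_eq_zero (hcon f (Finsupp.mem_support_iff.1 hf) hfe), mul_zero]
    · simp [Finsupp.notMem_support_iff.1 h]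
  rw [hc] at h1
  exact mul_ne_zero he (rep_apply_ne_zero hv) h1.symm

theorem exists_add_eq (c : E →₀ F) (S : Set E) : ∃ a b : E →₀ F, c = a + b ∧
    (∀ e ∉ S, a e = 0) ∧ (∀ e ∈ S, a e = c e) ∧ (∀ e ∈ S, b e = 0) ∧ ∀ e ∉ S, b e = c e := by
  classical
  refine ⟨c.filter (· ∈ S), c.filter (fun e => ¬ e ∈ S), (Finsupp.filter_add_filter_not c _).symm,
    ?_, ?_, ?_, ?_⟩ <;> intro e he <;> simp [he]

/-- A linear combination on a path whose value is known except in the last node is determined. -/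
theorem GainPath.exists_combination {P : Set E} {U : Set N} {u w : N} {g : Fˣ}
    (p : Φ.GainPath P U u w g) : ∃ q : E →₀ F, (∀ e, q e ≠ 0 ↔ e ∈ P) ∧
      Φ.boundary q = Finsupp.single u 1 - Finsupp.single w (g : F) ∧
      ∀ (c : E →₀ F) (t : F), (∀ e ∉ P, c e = 0) →
        (∀ v ∈ U, v ≠ w → Φ.boundary c v = Finsupp.single u t v) → c = t • q := by
  induction p with
  | nil u =>
    refine ⟨0, by simp, by simp, fun c t hc _ => ?_⟩
    ext e
    simpa using hc e
  | @cons P U u v w g e he hu p ih =>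
    obtain ⟨q, hq, hbq, huniq⟩ := ih
    have huv : u ≠ v := by rintro rfl; exact hu p.start_mem
    have huw : u ≠ w := by rintro rfl; exact hu p.end_mem
    have heP : e ∉ P := fun h => hu (p.mem_of_mem_ends h (by simp [he]))
    obtain ⟨k, hk, hX⟩ := rep_link huv he
    -- The coefficient `k⁻¹` normalizes the new edge to û - φv̂; adding φ times the old combination,
    -- with boundary v̂ - gŵ, cancels v̂. The left factor φ gives the gains in path order.
    refine ⟨Finsupp.single e k⁻¹ + (Φ.gain e u v : F) • q, fun f => ?_, ?_, fun c t hc ht => ?_⟩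
    · by_cases hfe : f = e
      · subst hfe
        have : q f = 0 := by by_contra h; exact heP ((hq f).1 h)
        simp [this, hk]
      · simp [hfe, hq]
    · rw [map_add, map_smul, hbq, boundary_single, hX]
      simp [smul_sub, hk, -Finsupp.single_mul]
    · obtain ⟨a, b, rfl, ha, ha', hb, hb'⟩ := exists_add_eq c {e}
      have ha2 : a = Finsupp.single e (a e) := by
        ext f
        by_cases hfe : f = e
        · simp [hfe]
        · simp [Ne.symm hfe, ha f hfe]
      have hbP : ∀ f ∉ P, b f = 0 := by
        intro f hf
        by_cases hfe : f = e
        · exact hb f hfe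
        · rw [hb' f hfe]
          exact hc f (by simp [hfe, hf])
      have hba : Φ.boundary a = Finsupp.single u (a e * k)
          - Finsupp.single v (a e * k * (Φ.gain e u v : F)) := by
        rw [ha2, boundary_single, hX]
        simp [smul_sub, mul_assoc, -Finsupp.single_mul]
      -- Only the edge `e` of the path meets `u`, so its coefficient is forced by the value there.
      have h1 : a e * k = t := by
        have h2 := ht u (by simp) huw
        rw [map_add, Finsupp.add_apply,
          boundary_apply_eq_zero hbP (fun h => hu (p.nodes_subset h)), hba] at h2
        simpa [huv.symm] using h2
      have h3 := huniq b (t * Φ.gain e u v) hbP (fun z hz hzw => by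
        have hzu : u ≠ z := by rintro rfl; exact hu hz
        have h2 := ht z (Or.inr hz) hzw
        rw [map_add, Finsupp.add_apply, hba, h1] at h2
        simp only [Finsupp.sub_apply, Finsupp.single_eq_of_ne hzu.symm] at h2
        rw [zero_sub, neg_add_eq_zero] at h2
        exact h2.symm)
      rw [h3, ha2, smul_add, ← h1, smul_smul]
      simp [mul_assoc, hk]

variable (Φ) in
/-- The points of `A` are independent, and the representatives of all of them are needed to
express the basis vector at `x`. -/
def SpansNode (A : Set E) (x : N) : Prop :=
  ∃ q : E →₀ F, (∀ e, q e ≠ 0 ↔ e ∈ A) ∧ Φ.boundary q = Finsupp.single x 1 ∧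
    ∀ c : E →₀ F, (∀ e ∉ A, c e = 0) → Φ.boundary c = 0 → c = 0

variable (Φ) in
/-- The linear relations between the points of `D` are the multiples of one with support `D`. -/
def HasUniqueRelation (D : Set E) : Prop :=
  ∃ q : E →₀ F, q ≠ 0 ∧ (∀ e, q e ≠ 0 ↔ e ∈ D) ∧ Φ.boundary q = 0 ∧
    ∀ c : E →₀ F, (∀ e ∉ D, c e = 0) → Φ.boundary c = 0 → ∃ t : F, c = t • q

theorem SpansNode.eq_smul {A : Set E} {x : N} {q : E →₀ F} (hq : ∀ e, q e ≠ 0 ↔ e ∈ A)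
    (hbq : Φ.boundary q = Finsupp.single x 1)
    (hA : ∀ c : E →₀ F, (∀ e ∉ A, c e = 0) → Φ.boundary c = 0 → c = 0)
    {c : E →₀ F} (hc : ∀ e ∉ A, c e = 0) (t : F) (h : Φ.boundary c = Finsupp.single x t) :
    c = t • q := by
  rw [← sub_eq_zero]
  refine hA _ (fun e he => ?_) ?_
  · have : q e = 0 := by by_contra h; exact he ((hq e).1 h)
    simp [this, hc e he]
  · rw [map_sub, map_smul, hbq, h]
    simp

/-- Two parts of a relation that meet in one node only. -/
theorem boundary_eq_single {a b : E →₀ F} {A B : Set E} {x : N} (hab : Φ.boundary (a + b) = 0)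
    (ha : ∀ e ∉ A, a e = 0) (hb : ∀ e ∉ B, b e = 0) (hAB : Φ.nodes A ∩ Φ.nodes B ⊆ {x}) :
    Φ.boundary a = Finsupp.single x (Φ.boundary a x) := by
  ext v
  by_cases hvx : v = x
  · simp [hvx]
  rw [Finsupp.single_eq_of_ne hvx]
  by_cases hvA : v ∈ Φ.nodes A
  · have hvB : v ∉ Φ.nodes B := fun h => hvx (hAB ⟨hvA, h⟩)
    have := DFunLike.congr_fun hab v
    rwa [map_add, Finsupp.add_apply, boundary_apply_eq_zero hb hvB, add_zero] at this
  · exact boundary_apply_eq_zero ha hvA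

/-- The relation is the difference of the two expressions for the vector at `x`. Any relation splits
into an `A`-part and a `B`-part with opposite boundaries; these are concentrated at the only common
node, so both parts are multiples of the given expressions by the same scalar. -/
theorem SpansNode.hasUniqueRelation {A B : Set E} {x : N} (hA : Φ.SpansNode A x)
    (hB : Φ.SpansNode B x) (hd : Disjoint A B) (hAB : Φ.nodes A ∩ Φ.nodes B ⊆ {x}) :
    Φ.HasUniqueRelation (A ∪ B) := by
  obtain ⟨p, hp, hbp, hpA⟩ := hA
  obtain ⟨q, hq, hbq, hqB⟩ := hB
  rw [Set.disjoint_left] at hd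
  refine ⟨p - q, fun h => ?_, fun e => ?_, by rw [map_sub, hbp, hbq, sub_self], fun c hc hbc => ?_⟩
  · have hp0 : p = 0 := by
      ext e
      by_contra hpe
      have hqe : q e = 0 := by
        by_contra hqe
        exact hd ((hp e).1 hpe) ((hq e).1 hqe)
      have := DFunLike.congr_fun h e
      rw [Finsupp.sub_apply, hqe, sub_zero] at this
      exact hpe this
    rw [hp0, map_zero] at hbp
    simpa using hbp.symm
  · by_cases heA : e ∈ A
    · have hqe : q e = 0 := by
        by_contra hqe
        exact hd heA ((hq e).1 hqe)
      simp [hqe, (hp e).2 heA, heA]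
    · have hpe : p e = 0 := by
        by_contra hpe
        exact heA ((hp e).1 hpe)
      simp [hpe, heA, ← hq e]
  · obtain ⟨a, b, rfl, ha, -, hb, hb'⟩ := exists_add_eq c A
    have hbB : ∀ e ∉ B, b e = 0 := by
      intro e he
      by_cases heA : e ∈ A
      · exact hb e heA
      · rw [hb' e heA]
        exact hc e (by simp [heA, he])
    have h1 := boundary_eq_single hbc ha hbB hAB
    have h2 := SpansNode.eq_smul hp hbp hpA ha _ h1
    have h3 : Φ.boundary b = Finsupp.single x (-(Φ.boundary a x)) := by
      rw [map_add] at hbc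
      rw [eq_neg_of_add_eq_zero_right hbc, Finsupp.single_neg, ← h1]
    have h4 := SpansNode.eq_smul hq hbq hqB hbB _ h3
    refine ⟨Φ.boundary a x, ?_⟩
    rw [smul_sub, sub_eq_add_neg, ← neg_smul, ← h2, ← h4]

/-- Subtracting û - gŵ from û leaves gŵ. For independence the path is read from `w` to `u`: the path
part of a relation has boundary zero away from `u`, so it vanishes. -/
theorem SpansNode.union_path {A P : Set E} {U : Set N} {u w : N} {g : Fˣ} (hA : Φ.SpansNode A u)
    (p : Φ.GainPath P U u w g) (hU : U ∩ Φ.nodes A ⊆ {u}) : Φ.SpansNode (A ∪ P) w := by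
  have hd := Set.disjoint_left.1 (p.disjoint_edges subset_rfl hU)
  have hU' : Φ.nodes A ∩ Φ.nodes P ⊆ {u} := fun z hz => hU ⟨p.nodes_subset hz.2, hz.1⟩
  obtain ⟨a, ha, hba, haA⟩ := hA
  obtain ⟨q, hq, hbq, -⟩ := p.exists_combination
  obtain ⟨q', hq', -, huniq⟩ := p.reverse.exists_combination
  have hg : ((g⁻¹ : Fˣ) : F) * g = 1 := by simp
  refine ⟨((g⁻¹ : Fˣ) : F) • (a - q), fun e => ?_, ?_, fun c hc hbc => ?_⟩
  · rw [Finsupp.smul_apply, smul_ne_zero_iff_right (Units.ne_zero _)]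
    by_cases heP : e ∈ P
    · have hae : a e = 0 := by
        by_contra hae
        exact hd heP ((ha e).1 hae)
      simp [hae, (hq e).2 heP, heP]
    · have hqe : q e = 0 := by
        by_contra hqe
        exact heP ((hq e).1 hqe)
      simp [hqe, heP, ← ha e]
  · rw [map_smul, map_sub, hba, hbq, sub_sub_cancel, Finsupp.smul_single, smul_eq_mul, hg]
  · obtain ⟨b, d, rfl, hb, -, hd', hd2⟩ := exists_add_eq c A
    have hdP : ∀ e ∉ P, d e = 0 := by
      intro e he
      by_cases heA : e ∈ A
      · exact hd' e heA
      · rw [hd2 e heA]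
        exact hc e (by simp [heA, he])
    have h1 := boundary_eq_single (by rwa [add_comm] at hbc) hdP hb
      (by rwa [Set.inter_comm] at hU')
    have h2 := huniq d 0 hdP (fun v hv hvu => by
      rw [h1, Finsupp.single_eq_of_ne hvu, Finsupp.single_zero, Finsupp.zero_apply])
    rw [zero_smul] at h2
    subst h2
    rw [add_zero] at hbc ⊢
    exact haA b hb hbc

theorem spansNode_half {e : E} {v : N} (he : Φ.ends e = s(v, v)) : Φ.SpansNode {e} v := by
  obtain ⟨k, hk, hX⟩ := rep_half he
  refine ⟨Finsupp.single e k⁻¹, fun f => ?_, ?_, fun c hc hbc => ?_⟩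
  · by_cases hfe : f = e
    · simp [hfe, hk]
    · simp [hfe]
  · rw [boundary_single, hX]
    simp [hk]
  · have hc2 : c = Finsupp.single e (c e) := by
      ext f
      by_cases hfe : f = e
      · simp [hfe]
      · simp [Ne.symm hfe, hc f hfe]
    rw [hc2, boundary_single, hX] at hbc
    rw [hc2]
    simpa [hk, -Finsupp.single_mul] using hbc

/-- The linear combinations on a circle. -/
theorem Closed.exists_combination {C : Set E} {U : Set N} {u w : N} {g : Fˣ}
    (h : Φ.Closed C U u w g) (huw : u ≠ w) : ∃ q : E →₀ F, (∀ e, q e ≠ 0 ↔ e ∈ C) ∧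
      Φ.boundary q = Finsupp.single u (1 - (g : F)) ∧
      ∀ (c : E →₀ F), (∀ e ∉ C, c e = 0) → Φ.boundary c = 0 →
        ∃ t : F, c = t • q := by
  obtain ⟨P, e, k, p, heP, hends, rfl, rfl⟩ := h
  obtain ⟨q, hq, hbq, huniq⟩ := p.exists_combination
  obtain ⟨m, hm, hX⟩ := rep_link huw.symm hends
  have hqe : q e = 0 := by by_contra h; exact heP ((hq e).1 h)
  -- The closing edge has to cancel the term -kŵ left over by the path, where `k` is the path gain
  -- and `m` the scalar of the representative.
  refine ⟨q + Finsupp.single e (k * m⁻¹), fun f => ?_, ?_, fun c hc hbc => ?_⟩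
  · by_cases hfe : f = e
    · subst hfe
      simp [hqe, hm]
    · simp [hfe, hq]
  · rw [map_add, hbq, boundary_single, hX]
    simp [smul_sub, hm, mul_assoc, -Finsupp.single_mul]
  · obtain ⟨a, b, rfl, ha, ha', hb, hb'⟩ := exists_add_eq c {e}
    have ha2 : a = Finsupp.single e (a e) := by
      ext f
      by_cases hfe : f = e
      · simp [hfe]
      · simp [Ne.symm hfe, ha f hfe]
    have hbP : ∀ f ∉ P, b f = 0 := by
      intro f hf
      by_cases hfe : f = e
      · exact hb f hfe
      · rw [hb' f hfe]
        exact hc f (by simp [hfe, hf])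
    have hba : Φ.boundary a = Finsupp.single w (a e * m)
        - Finsupp.single u (a e * m * (Φ.gain e w u : F)) := by
      rw [ha2, boundary_single, hX]
      simp [smul_sub, mul_assoc, -Finsupp.single_mul]
    have hbb : Φ.boundary b = Finsupp.single u (a e * m * (Φ.gain e w u : F))
        - Finsupp.single w (a e * m) := by
      rw [map_add, hba] at hbc
      rw [eq_neg_of_add_eq_zero_right hbc, neg_sub]
    have h1 := huniq b (a e * m * (Φ.gain e w u : F)) hbP (fun z hz hzw => by
      rw [hbb]
      simp [Ne.symm hzw])
    refine ⟨a e * m * (Φ.gain e w u : F), ?_⟩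
    -- Comparing the coefficients at `w` shows that the multiple found on the path also gives the
    -- coefficient of the closing edge.
    have h2 : a e * m = a e * m * (Φ.gain e w u : F) * k := by
      have h3 := DFunLike.congr_fun hbb w
      rw [h1, map_smul, hbq] at h3
      simpa [huw, huw.symm] using h3.symm
    rw [smul_add, ← h1, add_comm, Finsupp.smul_single, smul_eq_mul, ← mul_assoc, ← h2,
      mul_assoc, mul_inv_cancel₀ hm, mul_one, ← ha2]

theorem Closed.hasUniqueRelation {C : Set E} {U : Set N} {u w : N}
    (h : Φ.Closed C U u w 1) (huw : u ≠ w) : Φ.HasUniqueRelation C := by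
  obtain ⟨q, hq, hbq, huniq⟩ := h.exists_combination huw
  refine ⟨q, fun h0 => ?_, hq, by simpa using hbq, huniq⟩
  obtain ⟨P, e, k, p, heP, hends, rfl, -⟩ := h
  exact (hq e).2 (by simp) (by simp [h0])

theorem Closed.spansNode {C : Set E} {U : Set N} {u w : N} {g : Fˣ}
    (h : Φ.Closed C U u w g) (huw : u ≠ w) (hg : g ≠ 1) : Φ.SpansNode C u := by
  obtain ⟨q, hq, hbq, huniq⟩ := h.exists_combination huw
  have hg' : (1 - (g : F)) ≠ 0 := by
    rw [sub_ne_zero, ne_comm]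
    simpa using hg
  refine ⟨(1 - (g : F))⁻¹ • q, fun e => ?_, ?_, fun c hc hbc => ?_⟩
  · rw [Finsupp.smul_apply, smul_ne_zero_iff_right (inv_ne_zero hg'), hq]
  · rw [map_smul, hbq, Finsupp.smul_single, smul_eq_mul, inv_mul_cancel₀ hg']
  · obtain ⟨t, rfl⟩ := huniq c hc hbc
    rw [map_smul, hbq, Finsupp.smul_single, smul_eq_mul, Finsupp.single_eq_zero] at hbc
    rw [(mul_eq_zero.1 hbc).resolve_right hg', zero_smul]

theorem spansNode_of_isUnbalancedFigure {A : Set E} (h : Φ.bias.IsUnbalancedFigure A) {x : N}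
    (hx : x ∈ Φ.nodes A) : Φ.SpansNode A x := by
  rcases h with ⟨e, v, he, rfl⟩ | ⟨hA, hA'⟩
  · obtain rfl : x = v := by
      obtain ⟨f, rfl, hx⟩ := hx
      change x ∈ Φ.bias.ends f at hx
      simpa [he] using hx
    exact spansNode_half he
  · obtain ⟨U, u, w, g, huw, h⟩ := closed_of_isCircle hA
    rw [h.nodes_eq] at hx
    obtain ⟨w', g', hxw, h'⟩ := h.rotate huw hx
    refine h'.spansNode hxw ?_
    rintro rfl
    exact hA' (h'.balanced hxw)

theorem hasUniqueRelation_of_balanced {C : Set E} (h : C ∈ Φ.bias.balanced) :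
    Φ.HasUniqueRelation C := by
  obtain ⟨U, u, w, huw, h⟩ := closed_of_balanced h
  exact h.hasUniqueRelation huw

/-- A balanced circle carries a nonzero relation, whichever starting point and direction certify its
balance. This replaces a direct check that gain product 1 is independent of both. -/
theorem not_balanced_of_spansNode {C : Set E} {x : N} (h : Φ.SpansNode C x) :
    C ∉ Φ.bias.balanced := by
  intro hC
  obtain ⟨q, hq0, hq, hbq, -⟩ := hasUniqueRelation_of_balanced hC
  obtain ⟨-, -, -, h⟩ := h
  exact hq0 (h q (fun e he => by by_contra h; exact he ((hq e).1 h)) hbq)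

theorem paths_balanced_iff {P Q : Set E} {U W : Set N} {u w : N} {g h : Fˣ}
    (p : Φ.GainPath P U u w g) (q : Φ.GainPath Q W u w h) (huw : u ≠ w) (hPQ : Disjoint P Q)
    (hUW : U ∩ W ⊆ {u, w}) : P ∪ Q ∈ Φ.bias.balanced ↔ g = h := by
  obtain ⟨x, y, k, hxy, hc, hk⟩ := exists_closed_of_paths p q huw hPQ hUW
  rw [← hk]
  constructor
  · intro hb
    by_contra hk1
    exact not_balanced_of_spansNode (hc.spansNode hxy hk1) hb
  · rintro rfl
    exact hc.balanced hxy

end GainGraph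

/-! ### Frame circuits and supports of linear relations. -/

namespace GainGraph

variable {F N E : Type*} [DivisionRing F] {Φ : GainGraph N E Fˣ}

/-- No other edge of the relation meets an interior node of the path, so the path part has boundary
zero there and is determined by its value at `u`. -/
theorem eq_smul_of_path {P S : Set E} {U : Set N} {u w : N} {q : E →₀ F} (huniq : ∀ (c : E →₀ F) (t : F), (∀ e ∉ P, c e = 0) →
      (∀ v ∈ U, v ≠ w → Φ.boundary c v = Finsupp.single u t v) → c = t • q)
    {a r : E →₀ F} (ha : ∀ e ∉ P, a e = 0) (hr : ∀ e ∉ S, r e = 0)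
    (h : Φ.boundary (a + r) = 0) (hPS : U ∩ Φ.nodes S ⊆ {u, w}) :
    a = Φ.boundary a u • q := by
  refine huniq a _ ha fun v hv hvw => ?_
  by_cases hvu : v = u
  · simp [hvu]
  · have hvS : v ∉ Φ.nodes S := fun h => by
      rcases hPS ⟨hv, h⟩ with h | h
      · exact hvu h
      · exact hvw h
    have := DFunLike.congr_fun h v
    rw [map_add, Finsupp.add_apply, boundary_apply_eq_zero hr hvS, add_zero] at this
    rw [this]
    simp [hvu]

/-- A relation is a combination of the three path combinations whose coefficients s, t, x satisfy s
+ t + x = 0 (at `u`) and sg₁ + tg₂ + xg₃ = 0 (at `w`). Imbalance means that the gains are distinct,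
so the solution is unique up to left scalars and has no zero coefficient. -/
theorem hasUniqueRelation_of_theta {P₁ P₂ P₃ : Set E} (h : Φ.IsTheta P₁ P₂ P₃)
    (h₁₂ : P₁ ∪ P₂ ∉ Φ.bias.balanced) (h₂₃ : P₂ ∪ P₃ ∉ Φ.bias.balanced)
    (h₁₃ : P₁ ∪ P₃ ∉ Φ.bias.balanced) : Φ.HasUniqueRelation (P₁ ∪ P₂ ∪ P₃) := by
  obtain ⟨u, w, huw, hp₁, hp₂, hp₃, d₁₂, d₂₃, d₁₃, n₁₂, n₂₃, n₁₃⟩ := h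
  obtain ⟨U₁, g₁, p₁⟩ := GainPath.of_isPath hp₁
  obtain ⟨U₂, g₂, p₂⟩ := GainPath.of_isPath hp₂
  obtain ⟨U₃, g₃, p₃⟩ := GainPath.of_isPath hp₃
  rw [p₁.nodes_eq huw, p₂.nodes_eq huw] at n₁₂
  rw [p₂.nodes_eq huw, p₃.nodes_eq huw] at n₂₃
  rw [p₁.nodes_eq huw, p₃.nodes_eq huw] at n₁₃
  have g₁₂ : (g₁ : F) - g₂ ≠ 0 := by
    rw [paths_balanced_iff p₁ p₂ huw d₁₂ n₁₂.subset] at h₁₂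
    exact sub_ne_zero.2 fun h => h₁₂ (Units.ext h)
  have g₂₃ : (g₂ : F) - g₃ ≠ 0 := by
    rw [paths_balanced_iff p₂ p₃ huw d₂₃ n₂₃.subset] at h₂₃
    exact sub_ne_zero.2 fun h => h₂₃ (Units.ext h)
  have g₁₃ : (g₁ : F) - g₃ ≠ 0 := by
    rw [paths_balanced_iff p₁ p₃ huw d₁₃ n₁₃.subset] at h₁₃
    exact sub_ne_zero.2 fun h => h₁₃ (Units.ext h)
  obtain ⟨q₁, hq₁, b₁, u₁⟩ := p₁.exists_combination
  obtain ⟨q₂, hq₂, b₂, u₂⟩ := p₂.exists_combination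
  obtain ⟨q₃, hq₃, b₃, u₃⟩ := p₃.exists_combination
  have z₁ : ∀ e ∉ P₁, q₁ e = 0 := fun e he => by by_contra h; exact he ((hq₁ e).1 h)
  have z₂ : ∀ e ∉ P₂, q₂ e = 0 := fun e he => by by_contra h; exact he ((hq₂ e).1 h)
  have z₃ : ∀ e ∉ P₃, q₃ e = 0 := fun e he => by by_contra h; exact he ((hq₃ e).1 h)
  rw [Set.disjoint_left] at d₁₂ d₂₃ d₁₃
  -- With the third coefficient normalized to 1, the equation at `u` makes the second one -1 - α,
  -- and the equation at `w` becomes this one.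
  obtain ⟨α, hα⟩ : ∃ α : F, α * (g₁ - g₂) = g₂ - g₃ :=
    ⟨(g₂ - g₃) * (g₁ - g₂ : F)⁻¹, inv_mul_cancel_right₀ g₁₂ _⟩
  have hα0 : α ≠ 0 := by
    rintro rfl
    rw [zero_mul] at hα
    exact g₂₃ hα.symm
  have hβ0 : -1 - α ≠ 0 := by
    intro h
    rw [← sub_eq_zero.1 h, neg_one_mul, neg_sub] at hα
    apply g₁₃
    rw [← sub_add_sub_cancel (g₁ : F) g₂ g₃, ← hα]
    abel
  have hsum : α * g₁ + (-1 - α) * g₂ + g₃ = 0 := by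
    have : α * (g₁ : F) + (-1 - α) * g₂ + g₃ = α * (g₁ - g₂) - (g₂ - g₃) := by
      noncomm_ring
    rw [this, hα, sub_self]
  have hsupp : ∀ e, (α • q₁ + (-1 - α) • q₂ + q₃) e ≠ 0 ↔ e ∈ P₁ ∪ P₂ ∪ P₃ := by
    intro e
    simp only [Finsupp.add_apply, Finsupp.smul_apply, smul_eq_mul, Set.mem_union]
    by_cases e₁ : e ∈ P₁
    · simp [z₂ e (d₁₂ e₁), z₃ e (d₁₃ e₁), e₁, hα0, (hq₁ e).2 e₁]
    by_cases e₂ : e ∈ P₂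
    · simp [z₁ e e₁, z₃ e (d₂₃ e₂), e₂, hβ0, (hq₂ e).2 e₂]
    · simp [z₁ e e₁, z₂ e e₂, e₁, e₂, ← hq₃ e]
  refine ⟨α • q₁ + (-1 - α) • q₂ + q₃, fun h0 => ?_, hsupp, ?_, fun c hc hbc => ?_⟩
  · cases p₁ with
    | nil => exact huw rfl
    | cons e he hu p => exact (hsupp e).2 (Or.inl (Or.inl (Set.mem_insert _ _))) (by simp [h0])
  · have : Φ.boundary (α • q₁ + (-1 - α) • q₂ + q₃)
        = Finsupp.single u (α + (-1 - α) + 1)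
          - Finsupp.single w (α * (g₁ : F) + (-1 - α) * g₂ + g₃) := by
      simp only [map_add, map_smul, b₁, b₂, b₃, smul_sub, Finsupp.smul_single, smul_eq_mul,
        mul_one, Finsupp.single_add]
      abel
    rw [this, hsum]
    simp
  · obtain ⟨a, r, rfl, ha, -, hr, hr'⟩ := exists_add_eq c P₁
    obtain ⟨b, d, rfl, hb, hb', hd, hd'⟩ := exists_add_eq r P₂
    have hdP : ∀ e ∉ P₃, d e = 0 := by
      intro e he
      by_cases e₂ : e ∈ P₂
      · exact hd e e₂
      rw [hd' e e₂]
      by_cases e₁ : e ∈ P₁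
      · exact hr e e₁
      rw [hr' e e₁]
      exact hc e (by simp [e₁, e₂, he])
    have hn : ∀ {S T : Set E} {U V W : Set N} (_ : Φ.nodes S ⊆ V) (_ : Φ.nodes T ⊆ W)
        (_ : U ∩ V ⊆ {u, w}) (_ : U ∩ W ⊆ {u, w}), U ∩ Φ.nodes (S ∪ T) ⊆ {u, w} := by
      intro S T U V W h1 h2 h3 h4
      rw [HalfEdgeGraph.nodes_union]
      rintro z ⟨hz, hz' | hz'⟩
      · exact h3 ⟨hz, h1 hz'⟩
      · exact h4 ⟨hz, h2 hz'⟩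
    have hs : ∀ {S T : Set E} {x y : E →₀ F} (_ : ∀ e ∉ S, x e = 0) (_ : ∀ e ∉ T, y e = 0),
        ∀ e ∉ S ∪ T, (x + y) e = 0 := by
      intro S T x y hx hy e he
      rw [Set.mem_union, not_or] at he
      rw [Finsupp.add_apply, hx e he.1, hy e he.2, add_zero]
    have ea := eq_smul_of_path u₁ ha (hs hb hdP) hbc
      (hn p₂.nodes_subset p₃.nodes_subset n₁₂.subset n₁₃.subset)
    have eb := eq_smul_of_path u₂ hb (hs ha hdP) (by rw [← hbc]; congr 1; abel)
      (hn p₁.nodes_subset p₃.nodes_subset (Set.inter_comm U₁ U₂ ▸ n₁₂.subset) n₂₃.subset)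
    have ed := eq_smul_of_path u₃ hdP (hs ha hb) (by rw [← hbc]; congr 1; abel)
      (hn p₁.nodes_subset p₂.nodes_subset (Set.inter_comm U₁ U₃ ▸ n₁₃.subset)
        (Set.inter_comm U₂ U₃ ▸ n₂₃.subset))
    generalize Φ.boundary a u = s at ea
    generalize Φ.boundary b u = t at eb
    generalize Φ.boundary d u = x at ed
    subst ea eb ed
    have hb0 : Finsupp.single u (s + t + x) - Finsupp.single w (s * g₁ + t * g₂ + x * (g₃ : F))
        = 0 := by
      rw [← hbc]
      simp only [map_add, map_smul, b₁, b₂, b₃, smul_sub, Finsupp.smul_single, smul_eq_mul,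
        mul_one, Finsupp.single_add]
      abel
    have k₁ : s + t + x = 0 := by
      simpa [huw] using DFunLike.congr_fun hb0 u
    have k₂ : s * g₁ + t * g₂ + x * (g₃ : F) = 0 := by
      have := DFunLike.congr_fun hb0 w
      simpa only [Finsupp.sub_apply, Finsupp.single_eq_of_ne huw.symm, Finsupp.single_eq_same,
        zero_sub, Finsupp.zero_apply, neg_eq_zero] using this
    have k₃ : t = -s - x := by
      rw [add_assoc] at k₁
      rw [eq_sub_iff_add_eq, eq_neg_of_add_eq_zero_right k₁]
    have k₄ : s = x * α := by
      refine mul_right_cancel₀ g₁₂ ?_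
      rw [mul_assoc, hα, ← sub_eq_zero, ← k₂, k₃]
      noncomm_ring
    refine ⟨x, ?_⟩
    have k₅ : t = x * (-1 - α) := by
      rw [k₃, k₄]
      noncomm_ring
    rw [k₅, k₄, smul_add, smul_add, smul_smul, smul_smul, add_assoc]

theorem hasUniqueRelation_of_isFrameCircuit {D : Set E} (h : Φ.bias.IsFrameCircuit D) :
    Φ.HasUniqueRelation D := by
  rcases h with h | ⟨P, Q, R, h, h1, h2, h3, rfl⟩ | ⟨A, B, v, hA, hB, hd, hAB, rfl⟩ |
    ⟨A, B, P, u, w, hA, hB, hAB, hP, hPA, hPB, rfl⟩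
  · exact hasUniqueRelation_of_balanced h
  · exact hasUniqueRelation_of_theta h h1 h2 h3
  · have hv := hAB.symm.subset rfl
    exact (spansNode_of_isUnbalancedFigure hA hv.1).hasUniqueRelation
      (spansNode_of_isUnbalancedFigure hB hv.2) hd hAB.subset
  · have hu := hPA.symm.subset rfl
    have hw := hPB.symm.subset rfl
    have huw : u ≠ w := by
      rintro rfl
      exact Set.disjoint_left.1 hAB hu.2 hw.2
    obtain ⟨U, g, p⟩ := GainPath.of_isPath hP
    have hn : Φ.nodes (A ∪ P) ∩ Φ.nodes B ⊆ {w} := by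
      rw [HalfEdgeGraph.nodes_union]
      rintro z ⟨hz | hz, hz'⟩
      · exact absurd hz' (Set.disjoint_left.1 hAB hz)
      · exact hPB.subset ⟨hz, hz'⟩
    refine ((spansNode_of_isUnbalancedFigure hA hu.2).union_path p
      (p.nodes_eq huw ▸ hPA.subset)).hasUniqueRelation
      (spansNode_of_isUnbalancedFigure hB hw.2) ?_ hn
    rw [Set.disjoint_union_left]
    constructor
    · rw [Set.disjoint_left]
      intro e he he'
      induction hz : Φ.ends e with | h a b =>
      exact Set.disjoint_left.1 hAB ⟨e, he, (by simp [hz] : a ∈ Φ.ends e)⟩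
        ⟨e, he', (by simp [hz] : a ∈ Φ.ends e)⟩
    · exact p.disjoint_edges (x := w) subset_rfl (p.nodes_eq huw ▸ hPB.subset)

/-- An edge that continues a path at its initial node. -/
theorem GainPath.exists_edge_at_start {D P : Set E} {U : Set N} {u w : N} {g : Fˣ}
    (hD : ∀ e ∈ D, ∀ v ∈ Φ.ends e, ∃ f ∈ D, f ≠ e ∧ v ∈ Φ.ends f)
    (p : Φ.GainPath P U u w g) (hP : P ⊆ D) (hu : u ∈ Φ.nodes D) :
    ∃ f ∈ D, f ∉ P ∧ u ∈ Φ.ends f := by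
  cases p with
  | nil =>
    obtain ⟨e, he, hu⟩ := hu
    exact ⟨e, he, by simp, hu⟩
  | cons e he huU p =>
    obtain ⟨f, hf, hfe, huf⟩ := hD e (hP (Set.mem_insert _ _)) u (by simp [he])
    refine ⟨f, hf, ?_, huf⟩
    rintro (h | h)
    · exact hfe h
    · exact huU (p.mem_of_mem_ends h huf)

theorem finite_nodes {D : Set E} (hD : D.Finite) : (Φ.nodes D).Finite := by
  have : Φ.nodes D = ⋃ e ∈ D, {v | v ∈ Φ.ends e} := by
    ext v; simp [HalfEdgeGraph.nodes]
  rw [this]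
  refine hD.biUnion fun e _ => ?_
  induction hz : Φ.ends e with | h a b =>
  refine (Set.toFinite {a, b}).subset fun z hz' => ?_
  simpa using hz'

/-- In a finite edge set there is a node set of a path that is maximal. -/
theorem exists_maximal_path {D : Set E} (hD : D.Finite) (hne : D.Nonempty) :
    ∃ P U u w g, Φ.GainPath P U u w g ∧ P ⊆ D ∧ U ⊆ Φ.nodes D ∧
      ∀ P' u' w' g', Φ.GainPath P' U u' w' g' → P' ⊆ D →
        ∀ f ∈ D, ∀ y, Φ.ends f = s(u', y) → y ∈ U := by
  -- Maximality is imposed on the node set instead of the path, so that it also applies to reversed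
  -- or rotated paths on the same nodes.
  let S : Set (Set N) := {U | ∃ P u w g, Φ.GainPath P U u w g ∧ P ⊆ D ∧ U ⊆ Φ.nodes D}
  have hS : S.Finite := (finite_nodes (Φ := Φ) hD).finite_subsets.subset
    fun U ⟨_, _, _, _, _, _, h⟩ => h
  have hSne : S.Nonempty := by
    obtain ⟨e, he⟩ := hne
    induction hz : Φ.ends e with | h a b =>
    refine ⟨{a}, _, _, _, _, .nil a, Set.empty_subset _, ?_⟩
    rintro z rfl
    exact ⟨e, he, by simp [hz]⟩
  obtain ⟨U, ⟨⟨P, u, w, g, p, hP, hU⟩, hmax⟩⟩ := hS.exists_maximal hSne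
  refine ⟨P, U, u, w, g, p, hP, hU, fun P' u' w' g' p' hP' f hf y hy => ?_⟩
  by_contra hyU
  have h1 : insert y U ∈ S := by
    refine ⟨_, _, _, _, .cons f (hy.trans Sym2.eq_swap) hyU p', Set.insert_subset hf hP', ?_⟩
    exact Set.insert_subset ⟨f, hf, by simp [hy]⟩ hU
  exact hyU (hmax h1 (Set.subset_insert _ _) (Set.mem_insert _ _))

/-- The support of a linear relation contains a frame circuit. -/
theorem exists_isFrameCircuit {c : E →₀ F} (hc : c ≠ 0) (hbc : Φ.boundary c = 0) :
    ∃ C, Φ.bias.IsFrameCircuit C ∧ ∀ e ∈ C, c e ≠ 0 := by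
  set D : Set E := {e | c e ≠ 0} with hDdef
  suffices ∃ C ⊆ D, Φ.bias.IsFrameCircuit C by
    obtain ⟨C, h1, h2⟩ := this
    exact ⟨C, h2, fun e he => h1 he⟩
  have hDfin : D.Finite := by
    refine c.support.finite_toSet.subset fun e he => ?_
    exact Finset.mem_coe.2 (Finsupp.mem_support_iff.2 he)
  have hDne : D.Nonempty := by
    obtain ⟨e, he⟩ := DFunLike.ne_iff.1 hc
    exact ⟨e, he⟩
  have hdeg : ∀ e ∈ D, ∀ v ∈ Φ.ends e, ∃ f ∈ D, f ≠ e ∧ v ∈ Φ.ends f :=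
    fun e he v hv => exists_ne_of_boundary_eq_zero hbc he hv
  obtain ⟨P, U, u, w, g, p, hP, hU, hmax⟩ := exists_maximal_path (Φ := Φ) hDfin hDne
  have finish : ∀ {P' : Set E} {u' w' x y : N} {g' : Fˣ} {e f : E},
      Φ.GainPath P' U u' w' g' → P' ⊆ D → Φ.ends e = s(u', y) → e ∈ D → e ∉ P' →
      Φ.ends f = s(w', x) → f ∈ D → f ∉ P' → e ≠ f → ∃ C ⊆ D, Φ.bias.IsFrameCircuit C := by
    intro P' u' w' x y g' e f p' hP' he heD heP hf hfD hfP hef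
    obtain ⟨C, hC, h⟩ := p'.exists_isFrameCircuit he (hmax _ _ _ _ p' hP' e heD y he) heP hf
      (hmax _ _ _ _ p'.reverse hP' f hfD x hf) hfP hef
    exact ⟨C, hC.trans (Set.insert_subset heD (Set.insert_subset hfD hP')), h⟩
  obtain ⟨e, heD, heP, y, he⟩ := p.exists_edge_at_start hdeg hP (hU p.start_mem)
  obtain ⟨f, hfD, hfP, x, hf⟩ := p.reverse.exists_edge_at_start hdeg hP (hU p.end_mem)
  -- If the same edge continues the path at both ends, it closes the path, and a further edge has to
  -- be found.
  by_cases hef : e = f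
  swap
  · exact finish p hP he heD heP hf hfD hfP hef
  subst hef
  by_cases huw : u = w
  · subst huw
    obtain ⟨rfl, rfl, -⟩ := p.eq_nil
    obtain ⟨f, hfD, hfe, z, hf'⟩ := hdeg e heD u (by simp [he])
    exact finish p hP he heD heP hf' hfD (by simp) hfe.symm
  have hwu : Φ.ends e = s(w, u) := by
    have h1 := he.symm.trans hf
    rw [Sym2.eq_iff] at h1
    rcases h1 with ⟨h1, -⟩ | ⟨rfl, rfl⟩
    · exact absurd h1 huw
    · exact hf
  have hZ : Φ.Closed (insert e P) U u w _ := ⟨P, e, _, p, heP, hwu, rfl, rfl⟩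
  have hZD : insert e P ⊆ D := Set.insert_subset heD hP
  rcases hZ.balanced_or_isUnbalancedFigure with hb | hb
  · exact ⟨_, hZD, Or.inl hb⟩
  -- If no other edge of the support met the circle, the part of `c` on the circle would itself be a
  -- relation, contrary to the independence of an unbalanced figure.
  obtain ⟨a, haU, f, hfD, hfZ, haf⟩ : ∃ a ∈ U, ∃ f ∈ D, f ∉ insert e P ∧ a ∈ Φ.ends f := by
    by_contra! hcon
    obtain ⟨-, -, -, hind⟩ := spansNode_of_isUnbalancedFigure hb
      (hZ.nodes_eq.symm ▸ p.start_mem : u ∈ Φ.nodes (insert e P))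
    obtain ⟨a, b, rfl, ha, ha', hb, hb'⟩ := exists_add_eq c (insert e P)
    have h0 : a = 0 := by
      refine hind a ha ?_
      ext v
      by_cases hv : v ∈ U
      · have h1 := DFunLike.congr_fun hbc v
        rwa [map_add, Finsupp.add_apply, boundary_apply_eq_zero (S := D \ insert e P) (c := b),
          add_zero] at h1
        · intro f hf
          by_cases hfZ : f ∈ insert e P
          · exact hb f hfZ
          · rw [hb' f hfZ]
            by_contra h
            exact hf ⟨h, hfZ⟩
        · rintro ⟨f, hf, hvf⟩
          exact hcon v hv f hf.1 hf.2 hvf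
      · refine boundary_apply_eq_zero ha fun h => hv ?_
        rwa [hZ.nodes_eq] at h
    refine heD ?_
    rw [← ha' e (Set.mem_insert _ _), h0, Finsupp.zero_apply]
  -- Restarted at `a`, the circle is a path continued by `f` at its start and by its own closing
  -- edge at its end; these differ, since `f` is not on the circle.
  obtain ⟨w', g', haw', P', e', k, p', he'P, he', hZ', -⟩ := hZ.rotate huw haU
  obtain ⟨y', hy'⟩ := haf
  rw [hZ'] at hfZ hZD
  refine finish p' ((Set.subset_insert _ _).trans hZD) hy' hfD
    (fun h => hfZ (Set.mem_insert_of_mem _ h)) he' (hZD (Set.mem_insert _ _)) he'P ?_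
  rintro rfl
  exact hfZ (Set.mem_insert _ _)

end GainGraph

/-! ### Transport of biased graphs along isomorphisms. -/

namespace HalfEdgeGraph

variable {N E N' E' : Type*} {Γ : HalfEdgeGraph N E} {Γ' : HalfEdgeGraph N' E'}
  {fN : N → N'} {fE : E → E'}

theorem IsCircle.image (hN : fN.Injective) (hE : fE.Injective)
    (h : ∀ e, Γ'.ends (fE e) = (Γ.ends e).map fN) {C : Set E} (hC : Γ.IsCircle C) :
    Γ'.IsCircle (fE '' C) := by
  obtain ⟨n, v, e, ⟨hv, he, hends⟩, rfl⟩ := hC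
  exact ⟨n, fN ∘ v, fE ∘ e, ⟨hN.comp hv, hE.comp he, fun i => by simp [h, hends]⟩,
    (Set.range_comp fE e).symm⟩

theorem IsPath.image (hN : fN.Injective) (h : ∀ e, Γ'.ends (fE e) = (Γ.ends e).map fN)
    {P : Set E} {u w : N} (hP : Γ.IsPath P u w) : Γ'.IsPath (fE '' P) (fN u) (fN w) := by
  obtain ⟨n, v, e, hv, rfl, rfl, hends, rfl⟩ := hP
  exact ⟨n, fN ∘ v, fE ∘ e, hN.comp hv, rfl, rfl, fun i => by simp [h, hends],
    (Set.range_comp fE e).symm⟩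

theorem nodes_image (h : ∀ e, Γ'.ends (fE e) = (Γ.ends e).map fN) (S : Set E) :
    Γ'.nodes (fE '' S) = fN '' Γ.nodes S := by
  ext v
  simp only [nodes, Set.mem_image, Set.mem_ofPred_eq, exists_exists_and_eq_and, h, Sym2.mem_map]
  grind

theorem IsTheta.image (hN : fN.Injective) (hE : fE.Injective)
    (h : ∀ e, Γ'.ends (fE e) = (Γ.ends e).map fN) {P Q R : Set E} (hT : Γ.IsTheta P Q R) :
    Γ'.IsTheta (fE '' P) (fE '' Q) (fE '' R) := by
  obtain ⟨u, w, huw, hP, hQ, hR, d₁, d₂, d₃, n₁, n₂, n₃⟩ := hT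
  refine ⟨fN u, fN w, hN.ne huw, hP.image hN h, hQ.image hN h, hR.image hN h,
    (Set.disjoint_image_iff hE).2 d₁, (Set.disjoint_image_iff hE).2 d₂,
    (Set.disjoint_image_iff hE).2 d₃, ?_, ?_, ?_⟩
  all_goals rw [nodes_image h, nodes_image h, ← Set.image_inter hN, ← Set.image_pair]
  · rw [n₁]
  · rw [n₂]
  · rw [n₃]

end HalfEdgeGraph

namespace GraphWithCircles

variable {N E N' E' : Type*} {Ω : GraphWithCircles N E} {Ω' : GraphWithCircles N' E'}

theorem IsBiasedGraph.of_isIso {fN : N → N'} {fE : E → E'} (hΩ : Ω.IsBiasedGraph)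
    (h : Ω.IsIso Ω' fN fE) : Ω'.IsBiasedGraph := by
  intro P Q R hT hPQ hQR
  let gN := Equiv.ofBijective fN h.bijective_nodes
  let gE := Equiv.ofBijective fE h.bijective_edges
  have hg : ∀ e, Ω.ends (gE.symm e) = (Ω'.ends e).map gN.symm := by
    intro e
    obtain ⟨e, rfl⟩ := gE.surjective e
    have he : Ω'.ends (gE e) = (Ω.ends e).map fN := h.ends_map e
    rw [gE.symm_apply_apply, he, Sym2.map_map]
    have : (gN.symm : N' → N) ∘ fN = id := funext gN.symm_apply_apply
    rw [this, Sym2.map_id, id]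
  have himage : ∀ S : Set E', fE '' (gE.symm '' S) = S := gE.image_symm_image
  have key : ∀ S, Ω'.IsCircle S → (gE.symm '' S ∈ Ω.balanced ↔ S ∈ Ω'.balanced) := by
    intro S hS
    have := h.balanced_iff _
      (HalfEdgeGraph.IsCircle.image gN.symm.injective gE.symm.injective hg hS)
    rwa [himage] at this
  have h1 := (key _ (Ω'.isCircle_of_mem _ hPQ)).2 hPQ
  have h2 := (key _ (Ω'.isCircle_of_mem _ hQR)).2 hQR
  rw [Set.image_union] at h1 h2
  have h3 := hΩ _ _ _ (hT.image gN.symm.injective gE.symm.injective hg) h1 h2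
  rwa [h.balanced_iff _ (Ω.isCircle_of_mem _ h3), ← Set.image_union, himage] at h3

end GraphWithCircles

/-! ### The points ê, cross-flats, and the projective matroid. -/

section

variable {F N E : Type*} [DivisionRing F]

theorem nodePoint_injective : Function.Injective (nodePoint F : N → ℙ F (N →₀ F)) := by
  intro v w h
  rw [nodePoint, nodePoint, Projectivization.mk_eq_mk_iff'] at h
  obtain ⟨a, ha⟩ := h
  by_contra hvw
  have := DFunLike.congr_fun ha v
  simp [hvw] at this

/-- A link point has two nonzero coordinates because its gain is a unit. -/
theorem linkPoint_ne_nodePoint {v w : N} (h : v ≠ w) (a : Fˣ) (x : N) :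
    linkPoint h (a : F) ≠ nodePoint F x := by
  intro hx
  rw [linkPoint_eq, nodePoint, Projectivization.mk_eq_mk_iff'] at hx
  obtain ⟨b, hb⟩ := hx
  have h1 := DFunLike.congr_fun hb v
  have h2 := DFunLike.congr_fun hb w
  by_cases hxv : x = v
  · subst hxv
    simp [h.symm] at h2
  · simp [h, Ne.symm hxv] at h1

namespace GainGraph

variable {Φ : GainGraph N E Fˣ}

theorem edgePoint_mem_range_nodePoint_iff {e : E} :
    Φ.edgePoint e ∈ Set.range (nodePoint F : N → ℙ F (N →₀ F)) ↔ (Φ.ends e).IsDiag := by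
  induction hz : Φ.ends e with | h a b =>
  rw [Sym2.mk_isDiag_iff]
  constructor
  · rintro ⟨v, hv⟩
    by_contra hab
    rw [Φ.edgePoint_link hab hz] at hv
    exact linkPoint_ne_nodePoint hab _ v hv.symm
  · rintro rfl
    exact ⟨a, (Φ.edgePoint_half hz).symm⟩

theorem ends_edgeMap (e : E) :
    Φ.menelaean.graph.ends (Φ.edgeMap e) = (Φ.ends e).map Φ.nodeMap := by
  induction hz : Φ.ends e with | h a b =>
  rw [Sym2.map_mk]
  by_cases hab : a = b
  · subst hab
    have h : Φ.edgePoint e = nodePoint F a := Φ.edgePoint_half hz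
    have h' : ((Φ.edgeMap e : Φ.menelaean.points) : ℙ F (N →₀ F)) ∈ Φ.menelaean.frame :=
      ⟨a, h.symm⟩
    rw [FramedPointSet.ends_eq_of_mem _ _ h']
    have : (⟨_, h'⟩ : Φ.menelaean.frame) = Φ.nodeMap a := Subtype.ext h
    rw [this]
  · refine (FramedPointSet.ends_eq_of_mem_span _ _ ?_ _ _ ?_).2
    · intro h
      refine hab ?_
      have h' := edgePoint_mem_range_nodePoint_iff.1 (show Φ.edgePoint e ∈ _ from h)
      rwa [hz, Sym2.mk_isDiag_iff] at h'
    · change Φ.edgePoint e ∈ Projectivization.Subspace.span {nodePoint F a, nodePoint F b}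
      rw [Φ.edgePoint_link hab hz]
      exact linkPoint_mem_span hab _

theorem nodeMap_injective : Function.Injective Φ.nodeMap := fun _ _ h =>
  nodePoint_injective (F := F) (Subtype.ext_iff.1 h)

theorem ends_eq_of_edgePoint_eq {e f : E} (h : Φ.edgePoint e = Φ.edgePoint f) :
    Φ.ends e = Φ.ends f := by
  have h1 := ends_edgeMap (Φ := Φ) e
  have h2 : Φ.edgeMap e = Φ.edgeMap f := Subtype.ext h
  rw [h2, ends_edgeMap] at h1
  exact (Sym2.map.injective nodeMap_injective h1).symm

/-- Equal points have the same endpoints. For links, the coordinate at `a` shows that the scalar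
between the two vectors is 1, and the coordinate at `b` that the gains agree, so distinct links
would form a balanced digon. -/
theorem edgePoint_injective
    (hdigon : ∀ e f : E, e ≠ f → ({e, f} : Set E) ∉ Φ.bias.balanced)
    (hhalf : ∀ (e f : E) (v : N), Φ.ends e = s(v, v) → Φ.ends f = s(v, v) → e = f) :
    Function.Injective Φ.edgePoint := by
  intro e f h
  have hends := ends_eq_of_edgePoint_eq h
  induction hz : Φ.ends e with | h a b =>
  by_cases hab : a = b
  · subst hab
    exact hhalf e f a hz (hends ▸ hz)
  by_contra hef
  have hz' : Φ.ends f = s(a, b) := hends ▸ hz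
  rw [Φ.edgePoint_link hab hz, Φ.edgePoint_link hab hz', linkPoint_eq, linkPoint_eq,
    Projectivization.mk_eq_mk_iff'] at h
  obtain ⟨k, hk⟩ := h
  have hk1 : k = 1 := by simpa [hab] using DFunLike.congr_fun hk a
  have hg : Φ.gain f a b = Φ.gain e a b := by
    subst hk1
    have := DFunLike.congr_fun hk b
    refine Units.ext ?_
    simpa [hab] using this
  refine hdigon e f hef ?_
  have hc : Φ.Closed {e, f} {a, b} a b 1 := by
    refine ⟨{e}, f, _, .single hz hab, Ne.symm hef, hz'.trans Sym2.eq_swap, Set.pair_comm _ _, ?_⟩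
    rw [Φ.gain_symm f a b hab hz', hg, mul_inv_cancel]
  exact hc.balanced hab

/-- The edges of a path are switched to gain `1` by suitable weights of the nodes. -/
theorem GainPath.exists_potential {P : Set E} {U : Set N} {u w : N} {g : Fˣ}
    (p : Φ.GainPath P U u w g) : ∃ f : N → Fˣ, f w = 1 ∧ f u = g ∧
      ∀ e ∈ P, ∀ a b, Φ.ends e = s(a, b) → f a = Φ.gain e a b * f b := by
  classical
  induction p with
  | nil u => exact ⟨fun _ => 1, rfl, rfl, by simp⟩
  | @cons P U u v w g e he hu p ih =>
    obtain ⟨f, hw, hv, hf⟩ := ih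
    have huv : u ≠ v := by rintro rfl; exact hu p.start_mem
    have huw : u ≠ w := by rintro rfl; exact hu p.end_mem
    refine ⟨Function.update f u (Φ.gain e u v * g), ?_, ?_, ?_⟩
    · rw [Function.update_of_ne huw.symm, hw]
    · rw [Function.update_self]
    · rintro e' (rfl | he') a b hab
      · rw [he, Sym2.eq_iff] at hab
        rcases hab with ⟨rfl, rfl⟩ | ⟨rfl, rfl⟩
        · rw [Function.update_self, Function.update_of_ne huv.symm, hv]
        · rw [Function.update_self, Function.update_of_ne huv.symm, hv, Φ.gain_symm _ _ _ huv he,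
            inv_mul_cancel_left]
      · have ha : a ≠ u := by
          rintro rfl
          exact hu (p.mem_of_mem_ends he' (by simp [hab]))
        have hb : b ≠ u := by
          rintro rfl
          exact hu (p.mem_of_mem_ends he' (by simp [hab]))
        rw [Function.update_of_ne ha, Function.update_of_ne hb]
        exact hf e' he' a b hab

/-- The flat is the hyperplane ∑ x_v f(v) = 0, where `f` is a potential of the path. It contains a
link point exactly when the gain is compatible with `f`, and it avoids N̂ because every f(v) is a
unit. -/
theorem exists_isCrossFlat_of_balanced {C : Set E} (hC : C ∈ Φ.bias.balanced) :
    ∃ t : Projectivization.Subspace F (N →₀ F), IsCrossFlat Φ.menelaean.frame t ∧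
      ∀ e ∈ C, Φ.edgePoint e ∈ t := by
  obtain ⟨U, u, w, huw, P, e, k, p, heP, hends, rfl, hk⟩ := closed_of_balanced hC
  obtain ⟨f, hw, hu, hf⟩ := p.exists_potential
  have hlink : ∀ e a b, a ≠ b → Φ.ends e = s(a, b) → f a = Φ.gain e a b * f b →
      Φ.edgePoint e ∈
        (LinearMap.ker (Finsupp.linearCombination F fun v => (f v : F))).projectivization := by
    intro e a b hab he h
    rw [Φ.edgePoint_link hab he, linkPoint_eq, Submodule.mk_mem_projectivization_iff]
    simp [h]
  refine ⟨(LinearMap.ker (Finsupp.linearCombination F fun v => (f v : F))).projectivization,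
    ?_, ?_⟩
  · rw [IsCrossFlat, Set.disjoint_right]
    rintro _ ⟨v, rfl⟩ hv
    have h1 : Finsupp.single v 1 ∈
        LinearMap.ker (Finsupp.linearCombination F fun v => (f v : F)) := hv
    simp at h1
  · rintro e' (rfl | he')
    · refine hlink _ w u huw.symm hends ?_
      -- For the closing edge, compatibility reads 1 = φk, which is the balance condition kφ = 1
      -- with the factors exchanged.
      rw [hw, hu, eq_comm, mul_eq_one_iff_inv_eq, ← mul_eq_one_iff_inv_eq.1 hk.symm, inv_inv]
    · induction hz : Φ.ends e' with | h a b =>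
      refine hlink _ a b (fun hab => ?_) hz (hf e' he' a b hz)
      exact p.not_isDiag he' (by rw [hz, Sym2.mk_isDiag_iff, hab])

/-- A flat contains the span of its points, and here the span contains a node. -/
theorem SpansNode.not_isCrossFlat {C : Set E} {x : N} (h : Φ.SpansNode C x)
    {t : Projectivization.Subspace F (N →₀ F)} (ht : ∀ e ∈ C, Φ.edgePoint e ∈ t) :
    ¬ IsCrossFlat Φ.menelaean.frame t := by
  obtain ⟨q, hq, hbq, -⟩ := h
  have h1 : Finsupp.single x 1 ∈ t.submodule := by
    rw [← hbq, boundary, Finsupp.linearCombination_apply]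
    refine Submodule.sum_mem _ fun e he => Submodule.smul_mem _ _ ?_
    rw [Projectivization.Subspace.mem_submodule_iff t (Projectivization.rep_nonzero _),
      Projectivization.mk_rep]
    exact ht e ((hq e).1 (Finsupp.mem_support_iff.1 he))
  rw [Projectivization.Subspace.mem_submodule_iff t (by simp)] at h1
  rw [IsCrossFlat, Set.not_disjoint_iff]
  exact ⟨_, h1, x, rfl⟩

/-- Two of the three paths form a balanced circle exactly when their gains agree, and equality is
transitive. -/
theorem isBiasedGraph_bias : Φ.bias.IsBiasedGraph := by
  rintro P Q R ⟨u, w, huw, hP, hQ, hR, d₁, d₂, d₃, n₁, n₂, n₃⟩ h₁ h₂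
  obtain ⟨U₁, g₁, p₁⟩ := GainPath.of_isPath hP
  obtain ⟨U₂, g₂, p₂⟩ := GainPath.of_isPath hQ
  obtain ⟨U₃, g₃, p₃⟩ := GainPath.of_isPath hR
  have e₁ : Φ.bias.nodes P = U₁ := p₁.nodes_eq huw
  have e₂ : Φ.bias.nodes Q = U₂ := p₂.nodes_eq huw
  have e₃ : Φ.bias.nodes R = U₃ := p₃.nodes_eq huw
  rw [e₁, e₂] at n₁
  rw [e₂, e₃] at n₂
  rw [e₁, e₃] at n₃
  rw [paths_balanced_iff p₁ p₂ huw d₁ n₁.subset] at h₁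
  rw [paths_balanced_iff p₂ p₃ huw d₂ n₂.subset] at h₂
  rw [paths_balanced_iff p₁ p₃ huw d₃ n₃.subset]
  exact h₁.trans h₂

theorem isIso_menelaean (hinj : Function.Injective Φ.edgePoint) :
    Φ.bias.IsIso Φ.menelaean.bias Φ.nodeMap Φ.edgeMap := by
  have hE : Function.Injective Φ.edgeMap := fun e f h => hinj (Subtype.ext_iff.1 h)
  refine ⟨⟨nodeMap_injective, ?_⟩, ⟨hE, ?_⟩, ends_edgeMap, fun C hC => ⟨fun h => ?_, fun h => ?_⟩⟩
  · rintro ⟨_, v, rfl⟩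
    exact ⟨v, rfl⟩
  · rintro ⟨_, e, rfl⟩
    exact ⟨e, rfl⟩
  · obtain ⟨t, ht, hCt⟩ := exists_isCrossFlat_of_balanced h
    refine ⟨hC.image nodeMap_injective hE ends_edgeMap, t, ht, ?_⟩
    rintro _ ⟨e, he, rfl⟩
    exact hCt e he
  · obtain ⟨-, t, ht, hCt⟩ := h
    by_contra hC'
    obtain ⟨U, u, w, g, huw, h⟩ := closed_of_isCircle hC
    have hg : g ≠ 1 := by
      rintro rfl
      exact hC' (h.balanced huw)
    exact (h.spansNode huw hg).not_isCrossFlat (fun e he => hCt _ ⟨e, he, rfl⟩) ht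

/-- Pulling the matroid back to `E` turns dependence into the existence of a nonzero element of the
kernel of `boundary` supported on the set. -/
theorem indep_comap_iff (hinj : Function.Injective Φ.edgePoint) {I : Set E} :
    ((projectiveMatroid Φ.menelaean.points).comap Φ.edgePoint).Indep I ↔
      ∀ c : E →₀ F, (∀ e ∉ I, c e = 0) → Φ.boundary c = 0 → c = 0 := by
  have h1 : ((projectiveMatroid Φ.menelaean.points).comap Φ.edgePoint).Indep I ↔
      LinearIndepOn F (Projectivization.rep ∘ Φ.edgePoint) I := by
    rw [Matroid.comap_indep_iff, and_iff_left hinj.injOn]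
    change Φ.edgePoint '' I ⊆ Set.range Φ.edgePoint ∧ Projectivization.Independent _ ↔ _
    rw [Projectivization.independent_coe_iff, and_iff_right (Set.image_subset_range _ _)]
    exact ⟨fun h => h.comp_of_image hinj.injOn, fun h => h.image_of_comp⟩
  rw [h1, linearIndepOn_iff]
  refine forall_congr' fun c => ?_
  rw [Finsupp.mem_supported']
  rfl

theorem isFrameMatroid_comap (hinj : Function.Injective Φ.edgePoint) :
    Φ.bias.IsFrameMatroid ((projectiveMatroid Φ.menelaean.points).comap Φ.edgePoint) := by
  set M := (projectiveMatroid Φ.menelaean.points).comap Φ.edgePoint with hM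
  have hE : M.E = Set.univ := Set.eq_univ_of_forall fun e => ⟨e, rfl⟩
  have hcircuit : ∀ C, Φ.bias.IsFrameCircuit C → M.IsCircuit C := by
    intro C hC
    obtain ⟨q, hq0, hq, hbq, huniq⟩ := hasUniqueRelation_of_isFrameCircuit hC
    rw [Matroid.isCircuit_iff_forall_ssubset, Matroid.Dep, hE, and_iff_left (Set.subset_univ _)]
    refine ⟨fun h => hq0 ?_, fun I hI => ?_⟩
    · exact (indep_comap_iff hinj).1 h q (fun e he => by by_contra h; exact he ((hq e).1 h)) hbq
    -- A relation on a proper subset is a multiple of the one with full support and vanishes at a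
    -- missing edge, so the multiple is zero.
    · refine (indep_comap_iff hinj).2 fun c hc hbc => ?_
      obtain ⟨t, rfl⟩ := huniq c (fun e he => hc e fun h => he (hI.subset h)) hbc
      obtain ⟨e, heC, heI⟩ := Set.exists_of_ssubset hI
      have h1 := hc e heI
      rw [Finsupp.smul_apply, smul_eq_mul] at h1
      rw [(mul_eq_zero.1 h1).resolve_right ((hq e).2 heC), zero_smul]
  refine ⟨hE, fun C => ⟨fun hC => ?_, hcircuit C⟩⟩
  have h1 := hC.not_indep
  rw [hM, indep_comap_iff hinj] at h1
  push Not at h1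
  obtain ⟨c, hc, hbc, hc0⟩ := h1
  -- A matroid circuit contains a frame circuit, which is dependent by the first half; minimality
  -- makes them equal.
  obtain ⟨D, hD, hDc⟩ := exists_isFrameCircuit hc0 hbc
  have hDC : D ⊆ C := fun e he => by
    by_contra h
    exact hDc e he (hc e h)
  rwa [← (Matroid.isCircuit_iff.1 hC).2 (hcircuit D hD).dep hDC]

theorem isMatroidIso_comap (hinj : Function.Injective Φ.edgePoint) :
    IsMatroidIso Φ.edgePoint ((projectiveMatroid Φ.menelaean.points).comap Φ.edgePoint)
      (projectiveMatroid Φ.menelaean.points) := by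
  refine ⟨⟨fun e he => he, hinj.injOn, ?_⟩, fun I _ => ?_⟩
  · rintro _ ⟨e, rfl⟩
    exact ⟨e, ⟨e, rfl⟩, rfl⟩
  · rw [Matroid.comap_indep_iff, and_iff_left hinj.injOn]

end GainGraph

end

theorem theoremT {F N E : Type*} [DivisionRing F] (Φ : GainGraph N E Fˣ)
    (hdigon : ∀ e f : E, e ≠ f → ({e, f} : Set E) ∉ Φ.bias.balanced)
    (hhalf : ∀ (e f : E) (v : N), Φ.ends e = s(v, v) → Φ.ends f = s(v, v) → e = f) :
    Φ.bias.IsBiasedGraph ∧ Φ.menelaean.bias.IsBiasedGraph ∧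
    Φ.bias.IsIso Φ.menelaean.bias Φ.nodeMap Φ.edgeMap ∧
    ∃ G : Matroid E, Φ.bias.IsFrameMatroid G ∧
      IsMatroidIso Φ.edgePoint G (projectiveMatroid Φ.menelaean.points) := by
  have hinj := GainGraph.edgePoint_injective hdigon hhalf
  have hiso := GainGraph.isIso_menelaean hinj
  exact ⟨GainGraph.isBiasedGraph_bias, GainGraph.isBiasedGraph_bias.of_isIso hiso, hiso, _,
    GainGraph.isFrameMatroid_comap hinj, GainGraph.isMatroidIso_comap hinj⟩
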